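/- Let $V$ be a finite set and let $G$ be a graph with node set $V$ whose edges are solid directed ($\rightarrow$), dashed directed ($\dashrightarrow$) or undirected ($-$), with at most one edge between any two nodes and no loops. Write $a\multimap b$ if $a\rightarrow b$, $a\dashrightarrow b$ or $a-b$ is in $G$. For $X\subseteq V$ let $$Fa(X)=\{b: b\rightarrow a \text{ in } G \text{ for some } a\in X\},\quad Mo(X)=\{b: b\dashrightarrow a \text{ in } G\text{ for some } a\in X\},$$ $$Pa(X)=Fa(X)\cup Mo(X),\qquad Ne(X)=\{b: b-a\text{ in } G\text{ for some } a\in X\},$$ and let $Nd(X)$ be the set of nodes $b$ such that no route $a\multimap\cdots\multimap b$ with $a\in X$ contains a directed (solid or dashed) edge; write $Fa(i)=Fa(\{i\})$, etc. A chain component of $G$ is a maximal non-empty set of nodes any two of which are joined by a route of undirected edges; $Cc(G)$ is the set of chain components. Assume that $G$ is a unified chain graph (UCG): $G$ has no semidirected cycle (a closed route $v_1\multimap v_2\multimap\cdots\multimap v_n=v_1$, $n\ge 2$, whose first edge is directed), and $Fa(K)\cap Mo(K)=\emptyset$ for all $K\in Cc(G)$. Let $p$ be a Gaussian distribution on $\mathbb{R}^V$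 with positive definite covariance matrix $\Sigma$. For $K\in Cc(G)$ let $$\beta_K=\Sigma_{K,Pa(K)}\Sigma_{Pa(K),Pa(K)}^{-1},\qquad \Lambda_K=\Sigma_{K,K}-\Sigma_{K,Pa(K)}\Sigma_{Pa(K),Pa(K)}^{-1}\Sigma_{Pa(K),K},$$ and let $\Omega^{K}=(\Sigma_{K\cup Pa(K),K\cup Pa(K)})^{-1}$ be the precision matrix of the marginal $p(K,Pa(K))$. Theorem. The following are equivalent. (a) $p$ factorizes as $p(V)=\prod_{K\in Cc(G)}p(K\mid Pa(K))$ (an almost-everywhere equality of Lebesgue densities, where $p(K\mid Pa(K))$ is the quotient of the marginal densities of $K\cup Pa(K)$ and $Pa(K)$), and for all $K\in Cc(G)$ and $i\in K$: $(\beta_K)_{i,j}=0$ for all $j\in Mo(K)\setminus Mo(i)$; $\Omega^{K}_{i,j}=0$ for all $j\in Fa(K)\setminus Fa(i)$; $(\Lambda_K^{-1})_{i,j}=0$ for all $j\in K\setminus(\{i\}\cup Ne(i))$. (b) $p$ satisfies the block-recursive Markov property with respect to $G$: for all $K\in Cc(G)$ and $i\in K$, the following conditional independences hold in $p$: (B1)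 $i\perp Nd(K)\setminus (K\cup Fa(K)\cup Mo(i))\mid Fa(K)\cup Mo(i)$; (B2) $i\perp Nd(K)\setminus (K\cup Fa(i)\cup Mo(K))\mid (K\setminus\{i\})\cup Fa(i)\cup Mo(K)$; (B3) $i\perp j\mid (K\setminus\{i,j\})\cup Pa(K)$ for all $j\in K\setminus(\{i\}\cup Ne(i))$. -/

import Mathlib

open MeasureTheory ProbabilityTheory

/-- A graph over `V` with solid directed edges, dashed directed edges and undirected edges, and with
at most one edge between any pair of nodes (and no loops). -/
structure MixedGraph (V : Type*) where
  /-- `solid a b` is the edge `a → b`. -/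
  solid : V → V → Prop
  /-- `dashed a b` is the dashed edge from `a` to `b`. -/
  dashed : V → V → Prop
  /-- `und.Adj a b` is the edge `a - b`. -/
  und : SimpleGraph V
  solid_asymm : ∀ a b, solid a b → ¬ solid b a
  dashed_asymm : ∀ a b, dashed a b → ¬ dashed b a
  not_dashed_of_solid : ∀ a b, solid a b → ¬ dashed a b ∧ ¬ dashed b a
  not_und_of_solid : ∀ a b, solid a b → ¬ und.Adj a b
  not_und_of_dashed : ∀ a b, dashed a b → ¬ und.Adj a b

namespace MixedGraph

variable {V : Type*}

/-- There is a directed edge (solid or dashed) from `a` to `b`. -/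
def Directed (G : MixedGraph V) (a b : V) : Prop := G.solid a b ∨ G.dashed a b

/-- `a ⊸ b`: there is a solid or a dashed edge from `a` to `b`, or an undirected edge. -/
def Step (G : MixedGraph V) (a b : V) : Prop := G.Directed a b ∨ G.und.Adj a b

/-- No semidirected cycle, i.e. no directed edge from `a` to `b` that is continued by
`b ⊸ ⋯ ⊸ a`. -/
def IsChainGraph (G : MixedGraph V) : Prop :=
  ∀ a b, G.Directed a b → ¬ Relation.ReflTransGen G.Step b a

section Finite

variable [Fintype V]

open Classical in
/-- The fathers of `X`: the tails of the solid directed edges into `X`. -/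
noncomputable def fa (G : MixedGraph V) (X : Finset V) : Finset V :=
  Finset.univ.filter fun b => ∃ a ∈ X, G.solid b a

open Classical in
/-- The mothers of `X`: the tails of the dashed directed edges into `X`. -/
noncomputable def mo (G : MixedGraph V) (X : Finset V) : Finset V :=
  Finset.univ.filter fun b => ∃ a ∈ X, G.dashed b a

open Classical in
/-- The parents of `X`: the tails of the directed edges into `X`. -/
noncomputable def pa (G : MixedGraph V) (X : Finset V) : Finset V :=
  Finset.univ.filter fun b => ∃ a ∈ X, G.Directed b a

open Classical in
/-- The neighbors of `X`. -/
noncomputable def ne (G : MixedGraph V) (X : Finset V) : Finset V :=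
  Finset.univ.filter fun b => ∃ a ∈ X, G.und.Adj b a

open Classical in
/-- The non-descendants of `X`: the nodes `b` such that no route `a ⊸ ⋯ ⊸ b` with `a ∈ X` contains
a directed edge. -/
noncomputable def nd (G : MixedGraph V) (X : Finset V) : Finset V :=
  Finset.univ.filter fun b => ¬ ∃ a ∈ X, ∃ c d, Relation.ReflTransGen G.Step a c ∧
    G.Directed c d ∧ Relation.ReflTransGen G.Step d b

/-- A chain component: a maximal (non-empty) set of nodes any two of which are joined by an
undirected route. -/
def IsChainComponent (G : MixedGraph V) (K : Finset V) : Prop :=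
  Maximal (fun S : Finset V => S.Nonempty ∧ ∀ a ∈ S, ∀ b ∈ S, G.und.Reachable a b) K

open Classical in
/-- The set of chain components. -/
noncomputable def chainComponents (G : MixedGraph V) : Finset (Finset V) :=
  Finset.univ.filter fun K => G.IsChainComponent K

/-- A unified chain graph: a chain graph no chain component of which has a node that is both a
father and a mother of it. -/
structure IsUCG (G : MixedGraph V) : Prop where
  isChainGraph : G.IsChainGraph
  disjoint_fa_mo : ∀ K, G.IsChainComponent K → Disjoint (G.fa K) (G.mo K)

end Finite

end MixedGraph

section Distribution

variable {V : Type*} [Fintype V]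

/-- `A` and `B` are conditionally independent given `C` in the distribution `P` of the random
variables indexed by `V` (the coordinate functions on `V → ℝ`). -/
def CondIndepGiven (P : Measure (V → ℝ)) [IsFiniteMeasure P] (A B C : Finset V) : Prop :=
  CondIndepFun (MeasurableSpace.comap (C.restrict (π := fun _ => ℝ)) inferInstance)
    (Finset.measurable_restrict C).comap_le
    (A.restrict (π := fun _ => ℝ)) (B.restrict (π := fun _ => ℝ)) P

/-- The covariance matrix of `P`. -/
noncomputable def covMat (P : Measure (V → ℝ)) : Matrix V V ℝ :=
  Matrix.of fun i j => cov[fun x => x i, fun x => x j; P]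

/-- The block of the covariance matrix with rows `A` and columns `B`. -/
noncomputable def covBlock (P : Measure (V → ℝ)) (A B : Finset V) : Matrix A B ℝ :=
  (covMat P).submatrix (fun i : A => (i : V)) (fun j : B => (j : V))

/-- The Lebesgue density of the marginal distribution of the variables in `A`, at the subvector
`x_A` of `x`. -/
noncomputable def margDensity (P : Measure (V → ℝ)) (A : Finset V) (x : V → ℝ) : ENNReal :=
  (P.map (A.restrict (π := fun _ => ℝ))).rnDeriv volume (A.restrict x)

variable [DecidableEq V]

/-- The conditional density `p(K | A)`, at the subvectors `x_K`, `x_A` of `x`. -/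
noncomputable def condDensity (P : Measure (V → ℝ)) (K A : Finset V) (x : V → ℝ) : ENNReal :=
  margDensity P (K ∪ A) x / margDensity P A x

/-- The matrix of the coefficients of the regression of `K` on `A`. -/
noncomputable def regCoef (P : Measure (V → ℝ)) (K A : Finset V) : Matrix K A ℝ :=
  covBlock P K A * (covBlock P A A)⁻¹

/-- The conditional covariance matrix of `K` given `A`. -/
noncomputable def condCov (P : Measure (V → ℝ)) (K A : Finset V) : Matrix K K ℝ :=
  covBlock P K K - covBlock P K A * (covBlock P A A)⁻¹ * covBlock P A K

/-- The precision matrix of the marginal distribution of the variables in `A`. -/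
noncomputable def precMat (P : Measure (V → ℝ)) (A : Finset V) : Matrix A A ℝ :=
  (covBlock P A A)⁻¹

/-- `p(V) = ∏ p(K | Pa(K))`, the product over the chain components `K`, as densities with respect
to Lebesgue measure. -/
def Factorizes (G : MixedGraph V) (P : Measure (V → ℝ)) : Prop :=
  ∀ᵐ x ∂(volume : Measure (V → ℝ)),
    P.rnDeriv volume x = ∏ K ∈ G.chainComponents, condDensity P K (G.pa K) x

/-- The zero restrictions on the regression coefficients, the precision matrix and the inverse
conditional covariance matrix that are associated with the missing edges of `G`. -/
structure ZeroRestrictions (G : MixedGraph V) (P : Measure (V → ℝ)) : Prop where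
  mothers : ∀ K, G.IsChainComponent K → ∀ (i : K) (j : G.pa K),
    (j : V) ∈ G.mo K \ G.mo {(i : V)} → regCoef P K (G.pa K) i j = 0
  fathers : ∀ K, G.IsChainComponent K → ∀ i j : (K ∪ G.pa K : Finset V),
    (i : V) ∈ K → (j : V) ∈ G.fa K \ G.fa {(i : V)} → precMat P (K ∪ G.pa K) i j = 0
  neighbors : ∀ K, G.IsChainComponent K → ∀ i j : K,
    (j : V) ∈ (K \ {(i : V)}) \ G.ne {(i : V)} → (condCov P K (G.pa K))⁻¹ i j = 0

/-- The block-recursive Markov property of `P` with respect to `G`. -/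
structure BlockRecursiveMarkov (G : MixedGraph V) (P : Measure (V → ℝ)) [IsFiniteMeasure P] :
    Prop where
  b1 : ∀ K, G.IsChainComponent K → ∀ i ∈ K,
    CondIndepGiven P {i} (((G.nd K \ K) \ G.fa K) \ G.mo {i}) (G.fa K ∪ G.mo {i})
  b2 : ∀ K, G.IsChainComponent K → ∀ i ∈ K,
    CondIndepGiven P {i} (((G.nd K \ K) \ G.fa {i}) \ G.mo K) ((K \ {i}) ∪ G.fa {i} ∪ G.mo K)
  b3 : ∀ K, G.IsChainComponent K → ∀ i ∈ K, ∀ j ∈ (K \ {i}) \ G.ne {i},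
    CondIndepGiven P {i} {j} ((K \ {i, j}) ∪ G.pa K)

end Distribution

/-! For a Gaussian vector, `i` is independent of `B` given `C` exactly when the residual of the
linear regression of `i` on `C` is uncorrelated with `B` (`condIndepGiven_singleton_iff`). Both
sides of the theorem thus become statements about the positive definite matrix S = Σ, phrased with
the coefficients `Matrix.coef` and the orthogonality relation `Matrix.ResidOrth`.

On the Markov side, the normal equations have a unique solution. If C ⊆ C' ⊆ B, orthogonality to B
of the residual on C therefore means that the regression on C' has zero coefficients off C and that
its residual is orthogonal to B (`residOrth_iff`). With C' = Pa(K) for (B1) and C' = (K ∪ Pa(K)) \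
{i} for (B2) and (B3), each independence splits into zero coefficients and, for (B1) and (B2),
orthogonality to Nd(K) \ K. The coefficients are those of (a): a row of a precision matrix is
proportional to a row of regression coefficients (`inv_diagBlock_eq_zero_iff`), and the inverse of
Λ_K is the K-block of Ω^K.

On the density side, let R send the variables to their residuals on the parents of their components.
R is unitriangular in ancestor order, and the quadratic form of p(K | Pa(K)) is that of the inverse
of Λ_K in the residuals of K. Hence p factorizes iff R S Rᵀ is block diagonal, i.e. iff residuals on
Pa(K) are orthogonal to Nd(K) \ K for all K (`factorizes_iff`).

The sides then differ only in the orthogonality coming from (B2), which follows from that for all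
members of K (`residOrth_extend`). -/

/-! ### Regression coefficients and orthogonality of residuals -/

section LinearAlgebra

variable {V : Type*} [Fintype V]

open Matrix

/-- The square block of `S` with rows and columns `A`. -/
abbrev Matrix.diagBlock (S : Matrix V V ℝ) (A : Finset V) : Matrix A A ℝ :=
  S.submatrix (fun i : A => (i : V)) (fun j : A => (j : V))

omit [Fintype V] in
lemma Matrix.PosDef.diagBlock {S : Matrix V V ℝ} (hS : S.PosDef) (A : Finset V) :
    (S.diagBlock A).PosDef :=
  hS.submatrix Subtype.val_injective

omit [Fintype V] in
lemma Matrix.PosDef.symm_apply {S : Matrix V V ℝ} (hS : S.PosDef) (i j : V) : S i j = S j i := by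
  simpa using hS.isHermitian.apply j i

lemma Finset.sum_eq_sum_coe_of_support {A : Finset V} {f : V → ℝ} (h : ∀ j ∉ A, f j = 0) :
    ∑ j, f j = ∑ j : A, f j := by
  rw [Finset.sum_coe_sort A f]
  exact (Finset.sum_subset (Finset.subset_univ A) fun j _ hj => h j hj).symm

/-- The hypotheses make every term of uᵀSu vanish, so definiteness forces u = 0. This is the source
of all uniqueness claims about regressions. -/
lemma Matrix.PosDef.eq_zero_of_support {S : Matrix V V ℝ} (hS : S.PosDef) {A : Finset V}
    {u : V → ℝ} (hu : ∀ j ∉ A, u j = 0) (h : ∀ j ∈ A, ∑ l, u l * S l j = 0) : u = 0 := by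
  by_contra hne
  have h1 := hS.dotProduct_mulVec_pos hne
  rw [dotProduct_mulVec] at h1
  refine h1.ne' (Finset.sum_eq_zero fun j _ => ?_)
  by_cases hj : j ∈ A
  · have := h j hj
    simp only [vecMul, dotProduct, Pi.star_apply, star_trivial]
    rw [this, zero_mul]
  · rw [hu j hj, mul_zero]

variable [DecidableEq V]

/-- The coefficients of the regression of `i` on `A` for the covariance matrix `S`, extended by
zero. -/
noncomputable def Matrix.coef (S : Matrix V V ℝ) (A : Finset V) (i : V) : V → ℝ := fun j =>
  if h : j ∈ A then ((fun a : A => S i a) ᵥ* (S.diagBlock A)⁻¹) ⟨j, h⟩ else 0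

omit [Fintype V] in
lemma Matrix.coef_of_notMem (S : Matrix V V ℝ) {A : Finset V} (i : V) {j : V} (hj : j ∉ A) :
    S.coef A i j = 0 := dif_neg hj

omit [Fintype V] in
lemma Matrix.coef_coe (S : Matrix V V ℝ) {A : Finset V} (i : V) (j : A) :
    S.coef A i j = ((fun a : A => S i a) ᵥ* (S.diagBlock A)⁻¹) j := dif_pos j.2

lemma Matrix.sum_coef_mul (S : Matrix V V ℝ) (A : Finset V) (i : V) (f : V → ℝ) :
    ∑ l, S.coef A i l * f l =
      ∑ l : A, ((fun a : A => S i a) ᵥ* (S.diagBlock A)⁻¹) l * f l := by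
  rw [Finset.sum_eq_sum_coe_of_support (A := A)]
  · simp_rw [S.coef_coe]
  · intro j hj
    rw [S.coef_of_notMem i hj, zero_mul]

lemma Matrix.PosDef.sum_coef_mul_eq {S : Matrix V V ℝ} (hS : S.PosDef) {A : Finset V} (i : V)
    {j : V} (hj : j ∈ A) : ∑ l, S.coef A i l * S l j = S i j := by
  rw [S.sum_coef_mul]
  change (((fun a : A => S i a) ᵥ* (S.diagBlock A)⁻¹) ᵥ* S.diagBlock A) ⟨j, hj⟩ = S i j
  rw [vecMul_vecMul, nonsing_inv_mul _ (hS.diagBlock A).det_pos.ne'.isUnit, vecMul_one]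

lemma Matrix.PosDef.eq_coef {S : Matrix V V ℝ} (hS : S.PosDef) {A : Finset V} {i : V}
    {w : V → ℝ} (hw : ∀ j ∉ A, w j = 0) (h : ∀ j ∈ A, ∑ l, w l * S l j = S i j) :
    w = S.coef A i := by
  rw [← sub_eq_zero]
  refine hS.eq_zero_of_support (A := A) (fun j hj => ?_) fun j hj => ?_
  · simp [hw j hj, S.coef_of_notMem i hj]
  · simp_rw [Pi.sub_apply, sub_mul, Finset.sum_sub_distrib]
    rw [h j hj, hS.sum_coef_mul_eq i hj, sub_self]

lemma Matrix.PosDef.coef_eq_coef_iff {S : Matrix V V ℝ} (hS : S.PosDef) {A A' : Finset V}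
    (hA : A ⊆ A') (i : V) :
    S.coef A i = S.coef A' i ↔ ∀ j ∈ A' \ A, S.coef A' i j = 0 := by
  refine ⟨fun h j hj => ?_, fun h => ?_⟩
  · rw [← h, S.coef_of_notMem i (Finset.mem_sdiff.1 hj).2]
  · refine (hS.eq_coef (fun j hj => ?_) fun j hj => hS.sum_coef_mul_eq i (hA hj)).symm
    by_cases hj' : j ∈ A'
    · exact h j (Finset.mem_sdiff.2 ⟨hj', hj⟩)
    · exact S.coef_of_notMem i hj'

/-- `i` is uncorrelated with the variables in `B` after regression on `C`. -/
def Matrix.ResidOrth (S : Matrix V V ℝ) (C : Finset V) (i : V) (B : Finset V) : Prop :=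
  ∀ j ∈ B, ∑ l, S.coef C i l * S l j = S i j

/-- The normal equations give orthogonality to the regressors for free, so members of C may be added
to or dropped from the target set. -/
lemma Matrix.PosDef.residOrth_union_iff {S : Matrix V V ℝ} (hS : S.PosDef) {C B B' : Finset V}
    {i : V} (h : B' ⊆ B) (h' : B ⊆ B' ∪ C) : S.ResidOrth C i B' ↔ S.ResidOrth C i B := by
  refine ⟨fun hB j hj => ?_, fun hB j hj => hB j (h hj)⟩
  rcases Finset.mem_union.1 (h' hj) with hj | hj
  · exact hB j hj
  · exact hS.sum_coef_mul_eq i hj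

/-- Since C' ⊆ B, the residual on C is already orthogonal to C', so by uniqueness it is also the
residual on C'. -/
lemma Matrix.PosDef.residOrth_iff {S : Matrix V V ℝ} (hS : S.PosDef) {C C' B : Finset V}
    (hC : C ⊆ C') (hB : C' ⊆ B) (i : V) :
    S.ResidOrth C i B ↔ (∀ j ∈ C' \ C, S.coef C' i j = 0) ∧ S.ResidOrth C' i B := by
  rw [← hS.coef_eq_coef_iff hC]
  refine ⟨fun h => ?_, fun ⟨h, h'⟩ j hj => h ▸ h' j hj⟩
  have : S.coef C i = S.coef C' i :=
    hS.eq_coef (fun j hj => S.coef_of_notMem i fun h' => hj (hC h')) fun j hj => h j (hB hj)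
  exact ⟨this, fun j hj => this ▸ h j hj⟩

/-- Row i of Ω S_UU = 1, divided by Ω_ii, is the system of normal equations for regressing i on U \
{i}, with solution −Ω_il / Ω_ii. -/
lemma Matrix.PosDef.inv_diagBlock_eq_zero_iff {S : Matrix V V ℝ} (hS : S.PosDef) {U : Finset V}
    (i j : U) (hij : (j : V) ≠ i) :
    (S.diagBlock U)⁻¹ i j = 0 ↔ S.coef (U \ {(i : V)}) i j = 0 := by
  set Ω := (S.diagBlock U)⁻¹ with hΩ
  have hpos : 0 < Ω i i := (hS.diagBlock U).inv.diag_pos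
  let w : V → ℝ := fun l => if h : l ∈ U \ {(i : V)} then
    -(Ω i ⟨l, (Finset.mem_sdiff.1 h).1⟩ / Ω i i) else 0
  have hw : w = S.coef (U \ {(i : V)}) i := by
    refine hS.eq_coef (fun l hl => dif_neg hl) fun k hk => ?_
    obtain ⟨hkU, hki⟩ := Finset.mem_sdiff.1 hk
    have hki' : k ≠ i := by simpa using hki
    have h1 : (Ω * S.diagBlock U) i ⟨k, hkU⟩ = 0 := by
      rw [hΩ, nonsing_inv_mul _ (hS.diagBlock U).det_pos.ne'.isUnit]
      exact one_apply_ne fun h => hki' (congrArg Subtype.val h).symm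
    rw [mul_apply, ← Finset.add_sum_erase _ _ (Finset.mem_univ i)] at h1
    rw [Finset.sum_eq_sum_coe_of_support (A := U),
      ← Finset.add_sum_erase _ _ (Finset.mem_univ i)]
    · have h2 : w i = 0 := by simp [w]
      have h3 : ∀ l ∈ Finset.univ.erase i, w l * S l k
          = -(Ω i i)⁻¹ * (Ω i l * S.diagBlock U l ⟨k, hkU⟩) := by
        intro l hl
        have hl' : (l : V) ∈ U \ {(i : V)} :=
          Finset.mem_sdiff.2 ⟨l.2, fun h => Finset.ne_of_mem_erase hl
            (Subtype.ext (Finset.mem_singleton.1 h))⟩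
        simp only [w, dif_pos hl', submatrix_apply]
        ring
      rw [h2, Finset.sum_congr rfl h3, ← Finset.mul_sum]
      simp only [submatrix_apply] at h1 ⊢
      field_simp
      linarith
    · intro l hl
      simp [w, hl]
  rw [← hw]
  have hj : (j : V) ∈ U \ {(i : V)} := by simpa using hij
  simp [w, hij, hpos.ne']

/-- The `i`-th residual of the regression of `K` on `A` has no further correlation with `N` once
the other members of `K` are included among the regressors. -/
lemma Matrix.PosDef.residOrth_extend {S : Matrix V V ℝ} (hS : S.PosDef) {K A N : Finset V}
    (h : ∀ i ∈ K, S.ResidOrth A i N) {i : V} (hi : i ∈ K) (hiA : i ∉ A) :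
    S.ResidOrth ((K ∪ A) \ {i}) i N := by
  set c := S.coef ((K ∪ A) \ {i}) i with hc
  let d : V → ℝ := Pi.single i 1 - c
  let r : V → V → ℝ := fun k => Pi.single k 1 - S.coef A k
  have hsum : ∀ (k : V) (f : V → ℝ) j,
      ∑ l, (Pi.single k 1 - f : V → ℝ) l * S l j = S k j - ∑ l, f l * S l j := by
    intro k f j
    simp [sub_mul, Finset.sum_sub_distrib, Pi.single_apply]
  have hsum2 : ∀ j, ∑ l, (∑ k ∈ K, d k * r k l) * S l j =
      ∑ k ∈ K, d k * (S k j - ∑ l, S.coef A k l * S l j) := by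
    intro j
    simp_rw [← hsum, Finset.sum_mul, Finset.mul_sum]
    rw [Finset.sum_comm]
    simp_rw [mul_assoc, r]
  -- The new residual d is a combination of the old residuals r_k: off A, r_k is the unit vector at
  -- k and d lives on K, while on A both sides are orthogonal to every regressor.
  have hd : (fun l => d l - ∑ k ∈ K, d k * r k l) = 0 := by
    refine hS.eq_zero_of_support (A := A) (fun l hl => ?_) fun j hj => ?_
    · have h1 : ∀ k, r k l = if k = l then 1 else 0 := fun k => by
        simp [r, S.coef_of_notMem k hl, Pi.single_apply, eq_comm]
      simp_rw [h1]
      by_cases hlK : l ∈ K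
      · simp [hlK]
      · have hli : l ≠ i := fun h => hlK (h ▸ hi)
        have : d l = 0 := by
          simp only [d, hc, Pi.sub_apply, Pi.single_eq_of_ne hli, zero_sub, neg_eq_zero]
          exact S.coef_of_notMem i (by simp [hlK, hl])
        simp [hlK, this]
    · simp_rw [sub_mul, Finset.sum_sub_distrib]
      have hj' : j ∈ (K ∪ A) \ {i} := by
        simp only [Finset.mem_sdiff, Finset.mem_union, hj, or_true, Finset.mem_singleton, true_and]
        exact fun h => hiA (h ▸ hj)
      rw [hsum2, hsum, hc, hS.sum_coef_mul_eq i hj', sub_self, zero_sub, neg_eq_zero]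
      refine Finset.sum_eq_zero fun k _ => ?_
      rw [hS.sum_coef_mul_eq k hj, sub_self, mul_zero]
  intro j hj
  have h2 : ∑ l, d l * S l j = 0 := by
    have : d = fun l => ∑ k ∈ K, d k * r k l := funext fun l => sub_eq_zero.1 (congrFun hd l)
    rw [this, hsum2]
    refine Finset.sum_eq_zero fun k hk => ?_
    rw [h k hk j hj, sub_self, mul_zero]
  rw [hsum] at h2
  linarith

end LinearAlgebra

/-! ### Schur complements and completion of the square -/

section Schur

open Matrix

lemma Matrix.PosDef.fromBlocks_schur {m n : Type*} [Fintype m] [Fintype n] [DecidableEq m]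
    [DecidableEq n] {A : Matrix m m ℝ} {B : Matrix m n ℝ} {D : Matrix n n ℝ}
    (hM : (fromBlocks A B Bᵀ D).PosDef) :
    D.PosDef ∧ (A - B * D⁻¹ * Bᵀ).PosDef ∧
    (fromBlocks A B Bᵀ D).det = D.det * (A - B * D⁻¹ * Bᵀ).det ∧
    (fromBlocks A B Bᵀ D)⁻¹.toBlocks₁₁ = (A - B * D⁻¹ * Bᵀ)⁻¹ ∧
    ∀ (x : m → ℝ) (y : n → ℝ),
      (Sum.elim x y) ⬝ᵥ (fromBlocks A B Bᵀ D)⁻¹ *ᵥ (Sum.elim x y) - y ⬝ᵥ D⁻¹ *ᵥ y =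
        (x - (B * D⁻¹) *ᵥ y) ⬝ᵥ (A - B * D⁻¹ * Bᵀ)⁻¹ *ᵥ (x - (B * D⁻¹) *ᵥ y) := by
  have hD : D.PosDef := hM.submatrix (e := Sum.inr) Sum.inr_injective
  have := hD.isUnit.invertible
  have hdet : (fromBlocks A B Bᵀ D).det = D.det * (A - B * D⁻¹ * Bᵀ).det := by
    rw [det_fromBlocks₂₂, invOf_eq_nonsing_inv]
  have hΛdet : (A - B * D⁻¹ * Bᵀ).det ≠ 0 := fun h => hM.det_pos.ne' (by rw [hdet, h, mul_zero])
  have := ((isUnit_iff_isUnit_det _).2 hΛdet.isUnit).invertible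
  have := hM.isUnit.invertible
  have hDt : (D⁻¹)ᵀ = D⁻¹ := by
    have := hD.inv.isHermitian
    simpa [IsHermitian, conjTranspose_eq_transpose_of_trivial] using this
  have hinv : (fromBlocks A B Bᵀ D)⁻¹ = fromBlocks ((A - B * D⁻¹ * Bᵀ)⁻¹)
      (-((A - B * D⁻¹ * Bᵀ)⁻¹ * B * D⁻¹)) (-(D⁻¹ * Bᵀ * (A - B * D⁻¹ * Bᵀ)⁻¹))
      (D⁻¹ + D⁻¹ * Bᵀ * (A - B * D⁻¹ * Bᵀ)⁻¹ * B * D⁻¹) := by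
    have : Invertible (A - B * ⅟D * Bᵀ) := by rwa [invOf_eq_nonsing_inv]
    have h := invOf_fromBlocks₂₂_eq A B Bᵀ D
    simpa only [invOf_eq_nonsing_inv] using h
  have hΛ : (A - B * D⁻¹ * Bᵀ).PosDef := by
    have h : (fromBlocks A B Bᵀ D)⁻¹.toBlocks₁₁.PosDef :=
      hM.inv.submatrix (e := Sum.inl) Sum.inl_injective
    rw [hinv, toBlocks_fromBlocks₁₁] at h
    simpa using h.inv
  refine ⟨hD, hΛ, hdet, ?_, fun x y => ?_⟩
  · rw [hinv, toBlocks_fromBlocks₁₁]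
  · rw [hinv, fromBlocks_mulVec]
    set E := (A - B * D⁻¹ * Bᵀ)⁻¹
    simp only [sumElim_dotProduct_sumElim, Sum.elim_comp_inl, Sum.elim_comp_inr,
      add_mulVec, neg_mulVec, mulVec_sub,
      dotProduct_add, dotProduct_sub, sub_dotProduct, dotProduct_neg, ← mulVec_mulVec]
    have h1 : ∀ (u : m → ℝ), (B *ᵥ D⁻¹ *ᵥ y) ⬝ᵥ u = y ⬝ᵥ D⁻¹ *ᵥ Bᵀ *ᵥ u := by
      intro u
      rw [mulVec_mulVec, mulVec_mulVec, dotProduct_comm, dotProduct_mulVec, dotProduct_comm,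
        ← mulVec_transpose, transpose_mul, hDt]
    simp only [h1]
    ring


variable {V : Type*} [Fintype V] [DecidableEq V]

/-- The Schur complement of the block `A` of `S` in the block `K ∪ A`. -/
noncomputable abbrev Matrix.schur (S : Matrix V V ℝ) (K A : Finset V) : Matrix K K ℝ :=
  S.diagBlock K - S.submatrix (fun i : K => (i : V)) (fun j : A => (j : V)) * (S.diagBlock A)⁻¹ *
    S.submatrix (fun i : A => (i : V)) (fun j : K => (j : V))

/-- The quadratic form of the precision matrix of the variables in `A`. -/
noncomputable def Matrix.precForm (S : Matrix V V ℝ) (A : Finset V) (y : V → ℝ) : ℝ :=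
  (fun a : A => y a) ⬝ᵥ (S.diagBlock A)⁻¹ *ᵥ (fun a : A => y a)

/-- Block inversion, transported along K ⊕ A ≃ K ∪ A. The determinant and the quadratic form serve
the conditional density; the equality of blocks turns Λ_K⁻¹ into part of a precision matrix. -/
lemma Matrix.PosDef.schur_aux {S : Matrix V V ℝ} (hS : S.PosDef) {K A : Finset V}
    (h : Disjoint K A) :
    (S.schur K A).PosDef ∧
    (S.diagBlock (K ∪ A)).det = (S.diagBlock A).det * (S.schur K A).det ∧
    (∀ i j : K, (S.diagBlock (K ∪ A))⁻¹ ⟨i, Finset.mem_union_left A i.2⟩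
      ⟨j, Finset.mem_union_left A j.2⟩ = (S.schur K A)⁻¹ i j) ∧
    ∀ y : V → ℝ, S.precForm (K ∪ A) y - S.precForm A y =
      (fun i : K => y i - ∑ l, S.coef A i l * y l) ⬝ᵥ
        (S.schur K A)⁻¹ *ᵥ fun i : K => y i - ∑ l, S.coef A i l * y l := by
  let e : K ⊕ A ≃ (K ∪ A : Finset V) := Equiv.Finset.union K A h
  have hB : S.submatrix (fun i : A => (i : V)) (fun j : K => (j : V)) =
      (S.submatrix (fun i : K => (i : V)) (fun j : A => (j : V)))ᵀ := by
    ext i j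
    exact hS.symm_apply _ _
  have hM : fromBlocks (S.diagBlock K) (S.submatrix (fun i : K => (i : V)) (fun j : A => (j : V)))
      (S.submatrix (fun i : K => (i : V)) (fun j : A => (j : V)))ᵀ (S.diagBlock A) =
      (S.diagBlock (K ∪ A)).submatrix e e := by
    rw [← hB]
    ext (i | i) (j | j) <;> rfl
  have hMinv := inv_submatrix_equiv (S.diagBlock (K ∪ A)) e e
  have hpd := (hS.diagBlock (K ∪ A)).submatrix e.injective
  rw [← hM] at hpd hMinv
  obtain ⟨-, h1, h2, h3, h4⟩ := hpd.fromBlocks_schur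
  rw [← hB] at h1
  refine ⟨h1, ?_, fun i j => ?_, fun y => ?_⟩
  · rw [hM, ← hB, det_submatrix_equiv_self] at h2
    exact h2
  · rw [hMinv, ← hB] at h3
    exact congrFun (congrFun h3 i) j
  · have h5 := h4 (fun i => y i) (fun a => y a)
    rw [hMinv, ← hB] at h5
    have h6 : (Sum.elim (fun i : K => y i) fun a : A => y a) =
      (fun u : (K ∪ A : Finset V) => y u) ∘ e := by
      ext (i | i) <;> rfl
    have h7 : (fun i : K => y i) - (S.submatrix (fun i : K => (i : V)) (fun j : A => (j : V)) *
        (S.diagBlock A)⁻¹) *ᵥ (fun a : A => y a) =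
        fun i : K => y i - ∑ l, S.coef A i l * y l := by
      ext i
      rw [S.sum_coef_mul]
      rfl
    rw [h7, h6, submatrix_mulVec_equiv, comp_equiv_dotProduct_comp_equiv] at h5
    simpa [precForm, Function.comp_assoc] using h5

end Schur

/-! ### Reduction of conditional to unconditional independence -/

section CondIndep

lemma condDistrib_ae_eq_const_iff {Ω β γ : Type*} {mΩ : MeasurableSpace Ω} {μ : Measure Ω}
    [MeasurableSpace β] [MeasurableSpace γ] [StandardBorelSpace β]
    [Nonempty β] [IsProbabilityMeasure μ] {f : Ω → β} {u : Ω → γ} (hf : Measurable f)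
    (hu : Measurable u) :
    condDistrib f u μ =ᵐ[μ.map u] Kernel.const _ (μ.map f) ↔ IndepFun u f μ := by
  have : IsProbabilityMeasure (μ.map f) := Measure.isProbabilityMeasure_map hf.aemeasurable
  rw [condDistrib_ae_eq_iff_measure_eq_compProd _ hf.aemeasurable,
    indepFun_iff_map_prod_eq_prod_map_map hu.aemeasurable hf.aemeasurable,
    Measure.compProd_const]

variable {Ω β γ : Type*} {m' mΩ : MeasurableSpace Ω} [StandardBorelSpace Ω]
  {hm' : m' ≤ mΩ} {μ : Measure Ω} [IsFiniteMeasure μ]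

lemma condExpKernel_ae_eq_self {h : Ω → ℝ} (hm : m' ≤ mΩ) (hh : Measurable[m'] h) :
    ∀ᵐ ω ∂μ.trim hm, ∀ᵐ ω' ∂condExpKernel μ m' ω, h ω' = h ω := by
  have hmeas : @MeasurableSet (Ω × Ω) (m'.prod mΩ) {p | h p.2 = h p.1} := by
    have h1 : @Measurable _ _ (m'.prod mΩ) _ fun p : Ω × Ω => h p.1 := hh.comp measurable_fst
    have h2 : @Measurable _ _ (m'.prod mΩ) _ fun p : Ω × Ω => h p.2 :=
      (hh.mono hm le_rfl).comp (@measurable_snd _ _ m' mΩ)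
    have h3 : @Measurable _ _ (m'.prod mΩ) _ fun p : Ω × Ω => h p.2 - h p.1 := h2.sub h1
    convert h3 (measurableSet_singleton 0) using 1
    ext p
    simp [sub_eq_zero]
  have hdiag : @Measurable Ω (Ω × Ω) mΩ (m'.prod mΩ) fun ω => (ω, ω) :=
    @Measurable.prodMk Ω mΩ Ω Ω m' mΩ _ _ (measurable_id.mono le_rfl hm) measurable_id
  -- Composing the trimmed measure with the conditional kernel gives the law of (ω, ω), which
  -- charges only the diagonal.
  refine Measure.ae_ae_of_ae_compProd (p := fun p : Ω × Ω => h p.2 = h p.1) ?_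
  rw [compProd_trim_condExpKernel]
  exact (@ae_map_iff Ω (Ω × Ω) mΩ (m'.prod mΩ) μ _
    (@Measurable.aemeasurable _ _ mΩ (m'.prod mΩ) _ μ hdiag) _ hmeas).2 (by simp)

/-- Under almost every conditional measure h is almost surely constant, so subtracting it is a mere
shift. -/
lemma ProbabilityTheory.CondIndepFun.sub_left [MeasurableSpace β] [StandardBorelSpace β]
    {f h : Ω → ℝ} {g : Ω → β} (hf : Measurable f) (hg : Measurable g)
    (hh : Measurable[m'] h) (hfg : CondIndepFun m' hm' f g μ) :
    CondIndepFun m' hm' (fun ω => f ω - h ω) g μ := by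
  have hf' : Measurable fun ω => f ω - h ω := hf.sub (hh.mono hm' le_rfl)
  rw [condIndepFun_iff_map_prod_eq_prod_map_map hf hg] at hfg
  rw [condIndepFun_iff_map_prod_eq_prod_map_map hf' hg]
  filter_upwards [hfg, condExpKernel_ae_eq_self hm' hh] with ω h1 h2
  rw [Kernel.map_apply _ (by fun_prop), Kernel.prod_apply, Kernel.map_apply _ hf,
    Kernel.map_apply _ hg] at h1
  rw [Kernel.map_apply _ (by fun_prop), Kernel.prod_apply, Kernel.map_apply _ hf',
    Kernel.map_apply _ hg]
  rw [← indepFun_iff_map_prod_eq_prod_map_map hf.aemeasurable hg.aemeasurable] at h1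
  rw [← indepFun_iff_map_prod_eq_prod_map_map hf'.aemeasurable hg.aemeasurable]
  have h3 : IndepFun (fun ω' => f ω' - h ω) g (condExpKernel μ m' ω) :=
    h1.comp (φ := fun t => t - h ω) (ψ := id) (by fun_prop) measurable_id
  refine h3.congr ?_ (Filter.EventuallyEq.refl _ _)
  filter_upwards [h2] with ω' h4
  rw [h4]

lemma condIndepFun_sub_iff [MeasurableSpace β] [StandardBorelSpace β]
    {f h : Ω → ℝ} {g : Ω → β} (hf : Measurable f) (hg : Measurable g)
    (hh : Measurable[m'] h) :
    CondIndepFun m' hm' (fun ω => f ω - h ω) g μ ↔ CondIndepFun m' hm' f g μ := by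
  refine ⟨fun H => ?_, fun H => H.sub_left hf hg hh⟩
  have hf' : Measurable fun ω => f ω - h ω := hf.sub (hh.mono hm' le_rfl)
  have := H.sub_left (h := fun ω => - h ω) hf' hg hh.neg
  simpa using this

/-- As f is independent of k, its conditional law given k is its own law. Conditional independence
then says that the law of f given (k, g) is still that law. -/
lemma condIndepFun_iff_indepFun_prodMk {α : Type*} [MeasurableSpace α] [MeasurableSpace β]
    [MeasurableSpace γ]
    [StandardBorelSpace α] [StandardBorelSpace β] [Nonempty α] [Nonempty β] [IsProbabilityMeasure μ]
    {f : Ω → α} {g : Ω → β} {k : Ω → γ} (hf : Measurable f) (hg : Measurable g)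
    (hk : Measurable k) (hfk : IndepFun k f μ) :
    CondIndepFun (MeasurableSpace.comap k inferInstance) hk.comap_le f g μ ↔
      IndepFun (fun ω => (k ω, g ω)) f μ := by
  have h1 := (condDistrib_ae_eq_const_iff hf hk).2 hfk
  have h2 : (condDistrib f k μ).prodMkRight β =ᵐ[μ.map fun ω => (k ω, g ω)]
      Kernel.const _ (μ.map f) := by
    have hq : Measure.QuasiMeasurePreserving Prod.fst (μ.map fun ω => (k ω, g ω)) (μ.map k) :=
      ⟨measurable_fst, by
        rw [Measure.map_map measurable_fst (hk.prodMk hg)]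
        exact Measure.AbsolutelyContinuous.rfl⟩
    filter_upwards [hq.ae h1] with p hp
    simpa using hp
  constructor
  · intro h
    have := (condIndepFun_iff_condDistrib_prod_ae_eq_prodMkRight hf hg hk).1 h.symm
    exact (condDistrib_ae_eq_const_iff hf (hk.prodMk hg)).1 (this.trans h2)
  · intro h
    refine ((condIndepFun_iff_condDistrib_prod_ae_eq_prodMkRight hf hg hk).2 ?_).symm
    exact ((condDistrib_ae_eq_const_iff hf (hk.prodMk hg)).2 h).trans h2.symm

end CondIndep

/-! ### Conditional independence in Gaussian distributions -/

section Gaussian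

variable {V : Type*} [Fintype V] [DecidableEq V]

omit [DecidableEq V] in
lemma memLp_two_eval (P : Measure (V → ℝ)) [IsGaussian P] (i : V) :
    MemLp (fun x : V → ℝ => x i) 2 P :=
  ((IsGaussian.hasGaussianLaw_id (μ := P)).map_fun (ContinuousLinearMap.proj (R := ℝ) i)).memLp_two

omit [DecidableEq V] in
lemma covariance_sub_sum_eval (P : Measure (V → ℝ)) [IsGaussian P] (w : V → ℝ) (i j : V) :
    cov[fun x => x i - ∑ l, w l * x l, fun x => x j; P] =
      covMat P i j - ∑ l, w l * covMat P l j := by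
  have h : ∀ l, MemLp (fun x : V → ℝ => w l * x l) 2 P := fun l =>
    (memLp_two_eval P l).const_mul _
  have h' : MemLp (fun x : V → ℝ => ∑ l, w l * x l) 2 P :=
    memLp_finsetSum _ fun l _ => h l
  rw [covariance_fun_sub_left (memLp_two_eval P i) h' (memLp_two_eval P j),
    covariance_fun_sum_left h (memLp_two_eval P j)]
  simp_rw [covariance_const_mul_left]
  rfl

/-- The coordinates in C and the linear residual are jointly Gaussian, so independence is the
vanishing of covariances. -/
lemma indepFun_restrict_sub_sum_iff (P : Measure (V → ℝ)) [IsGaussian P] (w : V → ℝ) (i : V)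
    (C : Finset V) :
    IndepFun (C.restrict (π := fun _ => ℝ)) (fun x => x i - ∑ l, w l * x l) P ↔
      ∀ j ∈ C, ∑ l, w l * covMat P l j = covMat P i j := by
  have hε : MemLp (fun x : V → ℝ => x i - ∑ l, w l * x l) 2 P :=
    (memLp_two_eval P i).sub (memLp_finsetSum _ fun l _ => (memLp_two_eval P l).const_mul _)
  constructor
  · intro h j hj
    have h1 : IndepFun (fun x : V → ℝ => x j) (fun x => x i - ∑ l, w l * x l) P :=
      h.comp (φ := fun y : C → ℝ => y ⟨j, hj⟩) (ψ := id) (by fun_prop) measurable_id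
    have h2 := h1.symm.covariance_eq_zero hε (memLp_two_eval P j)
    rw [covariance_sub_sum_eval] at h2
    linarith
  · intro h
    have hlaw : HasGaussianLaw (fun x : V → ℝ => ((fun c : C => x c),
        fun _ : Unit => x i - ∑ l, w l * x l)) P := by
      let L : (V → ℝ) →L[ℝ] (C → ℝ) × (Unit → ℝ) :=
        (ContinuousLinearMap.pi fun c : C => ContinuousLinearMap.proj (R := ℝ) (c : V)).prod
          (ContinuousLinearMap.pi fun _ => ContinuousLinearMap.proj (R := ℝ) i -
            ∑ l, w l • ContinuousLinearMap.proj (R := ℝ) l)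
      have := (IsGaussian.hasGaussianLaw_id (μ := P)).map_fun L
      have heq : (fun x : V → ℝ => ((fun c : C => x c), fun _ : Unit => x i - ∑ l, w l * x l)) =
          fun x => L (id x) := by
        ext x <;> simp [L]
      rw [heq]
      exact this
    have h1 := hlaw.indepFun_of_covariance_eval
      (X := fun (c : C) (x : V → ℝ) => x c) (Y := fun _ x => x i - ∑ l, w l * x l) ?_
    · exact h1.comp (φ := id) (ψ := fun y : Unit → ℝ => y ()) measurable_id (by fun_prop)
    · intro c _
      rw [covariance_comm, covariance_sub_sum_eval, h c c.2, sub_self]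

/-- In a Gaussian distribution, `i` is independent of `B` given `C` iff the residual of the
regression of `i` on `C` is uncorrelated with `B`. -/
theorem condIndepGiven_singleton_iff {P : Measure (V → ℝ)} [IsGaussian P]
    (hP : (covMat P).PosDef) (i : V) (B C : Finset V) :
    CondIndepGiven P {i} B C ↔ (covMat P).ResidOrth C i B := by
  set w := (covMat P).coef C i with hw
  have hC : Measurable (C.restrict (π := fun _ : V => ℝ)) := Finset.measurable_restrict C
  have hB : Measurable (B.restrict (π := fun _ : V => ℝ)) := Finset.measurable_restrict B
  have hi : Measurable fun x : V → ℝ => x i := measurable_pi_apply i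
  have hε : Measurable fun x : V → ℝ => x i - ∑ l, w l * x l := by fun_prop
  have h1 : CondIndepGiven P {i} B C ↔
      CondIndepFun (MeasurableSpace.comap (C.restrict (π := fun _ => ℝ)) inferInstance)
        hC.comap_le (fun x => x i) (B.restrict (π := fun _ => ℝ)) P := by
    constructor
    · intro h
      exact h.comp (φ := fun y : ({i} : Finset V) → ℝ => y ⟨i, Finset.mem_singleton_self i⟩)
        (ψ := id) (by fun_prop) measurable_id
    · intro h
      have h' := h.comp (φ := fun (t : ℝ) (_ : ({i} : Finset V)) => t) (ψ := id) (by fun_prop)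
        measurable_id
      have heq : Finset.restrict (π := fun _ : V => ℝ) {i} =
          (fun (t : ℝ) (_ : ({i} : Finset V)) => t) ∘ fun x => x i := by
        ext x ⟨a, ha⟩
        obtain rfl := Finset.mem_singleton.1 ha
        rfl
      rw [CondIndepGiven, heq]
      exact h'
  have hm : Measurable[MeasurableSpace.comap (C.restrict (π := fun _ : V => ℝ)) inferInstance]
      fun x : V → ℝ => ∑ l, w l * x l := by
    have : (fun x : V → ℝ => ∑ l, w l * x l) =
        (fun y : C → ℝ => ∑ l : C, w l * y l) ∘ C.restrict (π := fun _ : V => ℝ) := by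
      ext x
      exact Finset.sum_eq_sum_coe_of_support fun j hj => by
        rw [hw, Matrix.coef_of_notMem _ i hj, zero_mul]
    rw [this]
    exact Measurable.comp (by fun_prop) (comap_measurable _)
  have h2 : IndepFun (C.restrict (π := fun _ => ℝ)) (fun x => x i - ∑ l, w l * x l) P :=
    (indepFun_restrict_sub_sum_iff P w i C).2 fun j hj => hP.sum_coef_mul_eq i hj
  -- The fitted value is a function of the variables in C and can be subtracted; the remaining
  -- residual is independent of C, so the conditioning can be removed.
  rw [h1, ← condIndepFun_sub_iff hi hB hm, condIndepFun_iff_indepFun_prodMk hε hB hC h2]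
  constructor
  · intro h
    exact (indepFun_restrict_sub_sum_iff P w i B).1
      (h.comp (φ := Prod.snd) (ψ := id) measurable_snd measurable_id)
  · intro h
    have h3 := (indepFun_restrict_sub_sum_iff P w i (B ∪ C)).2
      ((hP.residOrth_union_iff Finset.subset_union_left subset_rfl).1 h)
    exact h3.comp (φ := fun y : (B ∪ C : Finset V) → ℝ =>
        ((fun c : C => y ⟨c, Finset.mem_union_right B c.2⟩),
          fun b : B => y ⟨b, Finset.mem_union_left C b.2⟩)) (ψ := id) (by fun_prop) measurable_id

end Gaussian

/-! ### Gaussian densities, marginal and conditional -/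

section Density

open Matrix

lemma pi_gaussianReal_eq_withDensity {ι : Type*} [Fintype ι] (m : ι → ℝ) :
    Measure.pi (fun i => gaussianReal (m i) 1) = (volume : Measure (ι → ℝ)).withDensity
      fun x => ENNReal.ofReal (∏ i, gaussianPDFReal (m i) 1 (x i)) := by
  refine Measure.pi_eq fun s hs => ?_
  rw [withDensity_apply _ (MeasurableSet.univ_pi hs), volume_pi, Measure.restrict_pi_pi,
    ← ofReal_integral_eq_lintegral_ofReal, integral_fintype_prod_eq_prod,
    ENNReal.ofReal_prod_of_nonneg]
  · exact Finset.prod_congr rfl fun i _ => (gaussianReal_apply_eq_integral _ one_ne_zero _).symm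
  · exact fun i _ => integral_nonneg fun x => gaussianPDFReal_nonneg _ _ _
  · exact Integrable.fintype_prod fun i => (integrable_gaussianPDFReal _ _).restrict
  · exact Filter.Eventually.of_forall fun x =>
      Finset.prod_nonneg fun i _ => gaussianPDFReal_nonneg _ _ _

open scoped MatrixOrder Matrix.Norms.L2Operator in
lemma Matrix.PosDef.exists_whitening {ι : Type*} [Fintype ι] [DecidableEq ι] {S : Matrix ι ι ℝ}
    (hS : S.PosDef) : ∃ A : Matrix ι ι ℝ, Aᵀ * A = S⁻¹ ∧ A * S * Aᵀ = 1 ∧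
      |A.det| = (√S.det)⁻¹ := by
  obtain ⟨A, hA⟩ := CStarAlgebra.nonneg_iff_eq_star_mul_self.mp hS.inv.posSemidef.nonneg
  rw [star_eq_conjTranspose, conjTranspose_eq_transpose_of_trivial] at hA
  have hdet : A.det ^ 2 = (S.det)⁻¹ := by
    have := congrArg det hA
    rw [det_mul, det_transpose, det_nonsing_inv, Ring.inverse_eq_inv'] at this
    rw [this, sq]
  have hdet0 : A.det ≠ 0 := by
    intro h
    rw [h] at hdet
    exact (inv_pos.2 hS.det_pos).ne (by simpa using hdet)
  refine ⟨A, hA.symm, ?_, ?_⟩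
  · have h1 : (Aᵀ * A) * S = 1 := by
      rw [← hA, nonsing_inv_mul _ hS.det_pos.ne'.isUnit]
    rw [mul_assoc] at h1
    exact mul_eq_one_comm.1 h1
  · rw [← Real.sqrt_sq_eq_abs, hdet, Real.sqrt_inv]

/-- The normalizing constant of a Gaussian density. -/
noncomputable def gaussConst (n : ℕ) (d : ℝ) : ℝ := ((√(2 * Real.pi)) ^ n)⁻¹ * (√d)⁻¹

lemma gaussConst_pos (n : ℕ) {d : ℝ} (hd : 0 < d) : 0 < gaussConst n d := by
  unfold gaussConst
  positivity

variable {ι : Type*} [Fintype ι] [DecidableEq ι]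

/-- The whitened coordinates are jointly Gaussian with identity covariance, hence independent with
unit variance. -/
lemma map_toLin'_eq_pi (Q : Measure (ι → ℝ)) [IsGaussian Q] {A : Matrix ι ι ℝ}
    (hA : A * covMat Q * Aᵀ = 1) :
    Q.map (fun x => A *ᵥ x) =
      Measure.pi fun i => gaussianReal ((A *ᵥ fun k => ∫ x, x k ∂Q) i) 1 := by
  let X : ι → (ι → ℝ) → ℝ := fun i x => ∑ k, A i k * x k
  have hX2 : ∀ i k, MemLp (fun x : ι → ℝ => A i k * x k) 2 Q := fun i k =>
    (memLp_two_eval Q k).const_mul _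
  have hcov : ∀ i j, cov[X i, X j; Q] = if i = j then 1 else 0 := by
    intro i j
    have h1 : (A * covMat Q * Aᵀ) i j = if i = j then 1 else 0 := by rw [hA, one_apply]
    rw [← h1, covariance_fun_sum_fun_sum (fun k => hX2 i k) (fun k => hX2 j k), mul_apply]
    simp_rw [covariance_const_mul_left, covariance_const_mul_right, mul_apply, Finset.sum_mul]
    rw [Finset.sum_comm]
    refine Finset.sum_congr rfl fun k _ => Finset.sum_congr rfl fun l _ => ?_
    simp only [transpose_apply, covMat, of_apply]
    ring
  have hlaw : HasGaussianLaw (fun x i => X i x) Q := by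
    have := (IsGaussian.hasGaussianLaw_id (μ := Q)).map_fun
      (LinearMap.toContinuousLinearMap (toLin' A))
    exact this
  have hind : iIndepFun X Q := hlaw.iIndepFun_of_covariance_eq_zero fun i j hij => by
    rw [hcov, if_neg hij]
  have hmeas : ∀ i, AEMeasurable (X i) Q := fun i => by fun_prop
  have h2 := (iIndepFun_iff_map_fun_eq_pi_map hmeas).1 hind
  have h3 : (fun x => A *ᵥ x) = fun x i => X i x := rfl
  rw [h3, h2]
  congr 1
  ext1 i
  rw [(hlaw.eval i).map_eq_gaussianReal, ← covariance_self (hmeas i), hcov, if_pos rfl,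
    Real.toNNReal_one]
  congr 1
  simp only [X]
  rw [integral_finsetSum _ fun k _ => (hX2 i k).integrable one_le_two]
  simp_rw [integral_const_mul]
  rfl

/-- The Lebesgue density of a Gaussian distribution with positive definite covariance matrix. -/
theorem rnDeriv_gaussian (Q : Measure (ι → ℝ)) [IsGaussian Q] (hQ : (covMat Q).PosDef) :
    Q.rnDeriv volume =ᵐ[volume] fun x => ENNReal.ofReal
      (gaussConst (Fintype.card ι) (covMat Q).det * Real.exp
        (-((fun i => x i - ∫ x, x i ∂Q) ⬝ᵥ (covMat Q)⁻¹ *ᵥ fun i => x i - ∫ x, x i ∂Q) / 2)) := by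
  obtain ⟨A, hA1, hA2, hA3⟩ := hQ.exists_whitening
  set m : ι → ℝ := fun k => ∫ x, x k ∂Q
  have hdet : A.det ≠ 0 := fun h => by
    have := inv_pos.2 (Real.sqrt_pos.2 hQ.det_pos)
    rw [← hA3, h, abs_zero] at this
    exact this.false
  set f : (ι → ℝ) → ENNReal := fun x => ENNReal.ofReal
      (gaussConst (Fintype.card ι) (covMat Q).det * Real.exp
        (-((fun i => x i - m i) ⬝ᵥ (covMat Q)⁻¹ *ᵥ fun i => x i - m i) / 2))
  let g : (ι → ℝ) → ENNReal := fun y =>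
    ENNReal.ofReal (∏ i, gaussianPDFReal ((A *ᵥ m) i) 1 (y i))
  have hfm : Measurable f := by
    refine ENNReal.measurable_ofReal.comp (Continuous.measurable ?_)
    fun_prop
  have hgm : Measurable g := by
    refine ENNReal.measurable_ofReal.comp (Finset.measurable_prod _ fun i _ => ?_)
    exact (measurable_gaussianPDFReal _ _).comp (measurable_pi_apply i)
  have hfg : ∀ x, f x = ENNReal.ofReal |A.det| * g (A *ᵥ x) := by
    intro x
    rw [← ENNReal.ofReal_mul (abs_nonneg _), hA3]
    refine congrArg ENNReal.ofReal ?_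
    have h1 : (fun i => x i - m i) ⬝ᵥ (covMat Q)⁻¹ *ᵥ (fun i => x i - m i) =
        ∑ i, ((A *ᵥ x) i - (A *ᵥ m) i) ^ 2 := by
      have h2 : (fun i => x i - m i) = x - m := rfl
      rw [h2, ← hA1, ← mulVec_mulVec, dotProduct_mulVec, vecMul_transpose, mulVec_sub]
      exact Finset.sum_congr rfl fun i _ => (sq _).symm
    simp only [h1]
    simp only [gaussianPDFReal, Finset.prod_mul_distrib, ← Real.exp_sum, gaussConst,
      Finset.prod_const, Finset.card_univ, NNReal.coe_one, mul_one, ← Finset.sum_div,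
      Finset.sum_neg_distrib, inv_pow]
    ring
  have hT : MeasurableEmbedding fun x : ι → ℝ => A *ᵥ x :=
    Continuous.measurableEmbedding (by fun_prop)
      (mulVec_injective_iff_isUnit.2 ((isUnit_iff_isUnit_det _).2 hdet.isUnit))
  -- The linear map A is injective, so it is enough to compare images under A, where Q is a product
  -- of one-dimensional Gaussians.
  have hmap : Q = volume.withDensity f := by
    refine hT.map_injective ?_
    rw [map_toLin'_eq_pi Q hA2, pi_gaussianReal_eq_withDensity]
    ext s hs
    have hvol : (volume : Measure (ι → ℝ)).map (fun x => A *ᵥ x) =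
        ENNReal.ofReal |A.det⁻¹| • volume := Real.map_matrix_volume_pi_eq_smul_volume_pi hdet
    rw [withDensity_apply _ hs, Measure.map_apply hT.measurable hs,
      withDensity_apply _ (hT.measurable hs)]
    simp_rw [hfg]
    have hgT : Measurable fun x : ι → ℝ => g (A *ᵥ x) := hgm.comp hT.measurable
    rw [lintegral_const_mul _ hgT,
      ← setLIntegral_map hs hgm hT.measurable, hvol, Measure.restrict_smul,
      lintegral_smul_measure, smul_eq_mul, ← mul_assoc, ← ENNReal.ofReal_mul (abs_nonneg _),
      ← abs_mul, mul_inv_cancel₀ hdet, abs_one, ENNReal.ofReal_one, one_mul]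
  conv_lhs => rw [hmap]
  exact Measure.rnDeriv_withDensity _ hfm


/-- Allows almost-everywhere statements on ℝ^A to be pulled back to ℝ^V. -/
lemma quasiMeasurePreserving_restrict {V : Type*} [Fintype V] [DecidableEq V] (A : Finset V) :
    Measure.QuasiMeasurePreserving (A.restrict (π := fun _ => ℝ)) volume volume := by
  have h := volume_preserving_piEquivPiSubtypeProd (fun _ : V => ℝ) (fun i => i ∈ A)
  convert Measure.quasiMeasurePreserving_fst.comp h.quasiMeasurePreserving <;> rfl

variable {V : Type*} [Fintype V] [DecidableEq V]

omit [DecidableEq V] in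
lemma isGaussian_map_restrict (P : Measure (V → ℝ)) [IsGaussian P] (A : Finset V) :
    IsGaussian (P.map (A.restrict (π := fun _ => ℝ))) :=
  ((IsGaussian.hasGaussianLaw_id (μ := P)).map_fun
    (ContinuousLinearMap.pi fun a : A => ContinuousLinearMap.proj (R := ℝ) (a : V))).isGaussian_map

omit [Fintype V] [DecidableEq V] in
lemma covMat_map_restrict (P : Measure (V → ℝ)) (A : Finset V) :
    covMat (P.map (A.restrict (π := fun _ => ℝ))) = (covMat P).diagBlock A := by
  ext i j
  exact covariance_map_fun (measurable_pi_apply i).aestronglyMeasurable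
    (measurable_pi_apply j).aestronglyMeasurable
    (Finset.measurable_restrict A).aemeasurable

/-- The marginal densities of a Gaussian distribution. -/
theorem margDensity_ae_eq {P : Measure (V → ℝ)} [IsGaussian P] (hP : (covMat P).PosDef)
    (A : Finset V) :
    margDensity P A =ᵐ[volume] fun x => ENNReal.ofReal
      (gaussConst A.card ((covMat P).diagBlock A).det * Real.exp
        (-(covMat P).precForm A (fun i => x i - ∫ x, x i ∂P) / 2)) := by
  have := isGaussian_map_restrict P A
  have hcov := covMat_map_restrict P A
  have h := rnDeriv_gaussian (P.map (A.restrict (π := fun _ => ℝ))) (hcov ▸ hP.diagBlock A)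
  filter_upwards [(quasiMeasurePreserving_restrict A).ae h] with x hx
  have hmean : ∀ a : A, ∫ y : A → ℝ, y a ∂(P.map (A.restrict (π := fun _ => ℝ))) =
      ∫ y, y a ∂P := fun a => integral_map (Finset.measurable_restrict A).aemeasurable
        (measurable_pi_apply a).aestronglyMeasurable
  simp_rw [hcov, hmean, Fintype.card_coe] at hx
  exact hx

theorem condDensity_ae_eq {P : Measure (V → ℝ)} [IsGaussian P] (hP : (covMat P).PosDef)
    {K A : Finset V} (h : Disjoint K A) :
    condDensity P K A =ᵐ[volume] fun x => ENNReal.ofReal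
      (gaussConst K.card ((covMat P).schur K A).det * Real.exp
        (-((covMat P).precForm (K ∪ A) (fun i => x i - ∫ x, x i ∂P) -
          (covMat P).precForm A (fun i => x i - ∫ x, x i ∂P)) / 2)) := by
  obtain ⟨h1, h2, -⟩ := hP.schur_aux h
  filter_upwards [margDensity_ae_eq hP (K ∪ A), margDensity_ae_eq hP A] with x hx hx'
  have hA := (hP.diagBlock A).det_pos
  rw [condDensity, hx, hx', ← ENNReal.ofReal_div_of_pos
    (mul_pos (gaussConst_pos _ hA) (Real.exp_pos _))]
  congr 1
  rw [mul_div_mul_comm, ← Real.exp_sub, h2, Finset.card_union_of_disjoint h]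
  congr 1
  · unfold gaussConst
    rw [Real.sqrt_mul hA.le, pow_add]
    have := Real.sqrt_pos.2 hA
    have := Real.sqrt_pos.2 h1.det_pos
    field_simp
  · congr 1
    ring

end Density

/-! ### Chain components, non-descendants and ancestor rank -/

namespace MixedGraph

variable {V : Type*} [Fintype V] {G : MixedGraph V}

open Relation

open Classical in
/-- The chain component of `i`. -/
noncomputable def comp (G : MixedGraph V) (i : V) : Finset V :=
  Finset.univ.filter fun j => G.und.Reachable i j

lemma mem_comp {i j : V} : j ∈ G.comp i ↔ G.und.Reachable i j := by simp [comp]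

lemma self_mem_comp (i : V) : i ∈ G.comp i := mem_comp.2 (SimpleGraph.Reachable.refl i)

lemma comp_eq_of_mem {i j : V} (h : j ∈ G.comp i) : G.comp j = G.comp i := by
  ext k
  rw [mem_comp] at h
  simp only [mem_comp]
  exact ⟨h.trans, h.symm.trans⟩

lemma isChainComponent_comp (i : V) : G.IsChainComponent (G.comp i) := by
  refine ⟨⟨⟨i, self_mem_comp i⟩, fun a ha b hb => ?_⟩, fun S hS hle b hb => ?_⟩
  · exact (mem_comp.1 ha).symm.trans (mem_comp.1 hb)
  · exact mem_comp.2 (hS.2 i (hle (self_mem_comp i)) b hb)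

lemma IsChainComponent.eq_comp {K : Finset V} (hK : G.IsChainComponent K) {i : V} (hi : i ∈ K) :
    K = G.comp i := by
  have h : K ⊆ G.comp i := fun j hj => mem_comp.2 (hK.1.2 i hi j hj)
  exact h.antisymm (hK.2 (isChainComponent_comp i).1 h)

lemma mem_chainComponents {K : Finset V} : K ∈ G.chainComponents ↔ G.IsChainComponent K := by
  simp [chainComponents]

lemma mem_fa {X : Finset V} {b : V} : b ∈ G.fa X ↔ ∃ a ∈ X, G.solid b a := by simp [fa]
lemma mem_mo {X : Finset V} {b : V} : b ∈ G.mo X ↔ ∃ a ∈ X, G.dashed b a := by simp [mo]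
lemma mem_pa {X : Finset V} {b : V} : b ∈ G.pa X ↔ ∃ a ∈ X, G.Directed b a := by simp [pa]

lemma pa_eq [DecidableEq V] (X : Finset V) : G.pa X = G.fa X ∪ G.mo X := by
  ext b
  simp only [mem_pa, Finset.mem_union, mem_fa, mem_mo, Directed, and_or_left, exists_or]

omit [Fintype V] in
lemma reachable_of_und {a b : V} (h : G.und.Reachable a b) : ReflTransGen G.Step a b := by
  rw [SimpleGraph.reachable_iff_reflTransGen] at h
  exact ReflTransGen.mono (fun _ _ h => Or.inr h) _ _ h

lemma notMem_nd {X : Finset V} {b : V} : b ∉ G.nd X ↔ ∃ a ∈ X, ∃ c d,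
    ReflTransGen G.Step a c ∧ G.Directed c d ∧ ReflTransGen G.Step d b := by
  simp [nd]

lemma mem_nd_of_reflTransGen {X : Finset V} {a b : V} (hb : b ∈ G.nd X)
    (h : ReflTransGen G.Step a b) : a ∈ G.nd X := by
  by_contra ha
  obtain ⟨x, hx, c, d, h1, h2, h3⟩ := notMem_nd.1 ha
  exact notMem_nd.2 ⟨x, hx, c, d, h1, h2, h3.trans h⟩ hb

lemma IsChainGraph.comp_subset_nd (hG : G.IsChainGraph) (i : V) : G.comp i ⊆ G.nd (G.comp i) := by
  intro b hb
  by_contra h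
  obtain ⟨a, ha, c, d, h1, h2, h3⟩ := notMem_nd.1 h
  exact hG c d h2 (h3.trans ((reachable_of_und ((mem_comp.1 hb).symm.trans (mem_comp.1 ha))).trans
    h1))

lemma IsChainGraph.disjoint_comp_pa (hG : G.IsChainGraph) (i : V) :
    Disjoint (G.comp i) (G.pa (G.comp i)) := by
  refine Finset.disjoint_left.2 fun b hb hb' => ?_
  obtain ⟨a, ha, hba⟩ := mem_pa.1 hb'
  exact hG b a hba (reachable_of_und ((mem_comp.1 ha).symm.trans (mem_comp.1 hb)))

lemma reflTransGen_of_mem_pa_comp {i j : V} (h : j ∈ G.pa (G.comp i)) :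
    ReflTransGen G.Step j i := by
  obtain ⟨a, ha, hja⟩ := mem_pa.1 h
  exact (ReflTransGen.single (r := G.Step) (Or.inl hja)).trans
    (reachable_of_und (mem_comp.1 ha).symm)

/-- The nondescendants of the component of `i` that do not belong to it are closed under parents of
components. -/
lemma mem_nd_sdiff_of_mem_pa [DecidableEq V] {i j l : V}
    (hj : j ∈ G.nd (G.comp i)) (hl : l ∈ G.pa (G.comp j)) :
    l ∈ G.nd (G.comp i) \ G.comp i := by
  refine Finset.mem_sdiff.2 ⟨mem_nd_of_reflTransGen hj (reflTransGen_of_mem_pa_comp hl), ?_⟩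
  intro hli
  obtain ⟨a, ha, hla⟩ := mem_pa.1 hl
  exact notMem_nd.2 ⟨l, hli, l, a, ReflTransGen.refl, hla,
    reachable_of_und (mem_comp.1 ha).symm⟩ hj

/-- Otherwise the two routes with directed edges, joined through the components, would close up to a
semidirected cycle. -/
lemma IsChainGraph.mem_nd_or_mem_nd (hG : G.IsChainGraph) (i j : V) :
    j ∈ G.nd (G.comp i) ∨ i ∈ G.nd (G.comp j) := by
  by_contra! h
  obtain ⟨a, ha, c, d, h1, h2, h3⟩ := notMem_nd.1 h.1
  obtain ⟨a', ha', c', d', h1', h2', h3'⟩ := notMem_nd.1 h.2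
  refine hG c d h2 (h3.trans ((reachable_of_und (mem_comp.1 ha')).trans (h1'.trans ?_)))
  exact (ReflTransGen.single (r := G.Step) (Or.inl h2')).trans
    (h3'.trans ((reachable_of_und (mem_comp.1 ha)).trans h1))

open Classical in
/-- The number of ancestors of a node. -/
noncomputable def rank (G : MixedGraph V) (i : V) : ℕ :=
  (Finset.univ.filter fun j => ReflTransGen G.Step j i).card

lemma IsChainGraph.rank_lt (hG : G.IsChainGraph) {i j : V} (h : j ∈ G.pa (G.comp i)) :
    G.rank j < G.rank i := by
  classical
  refine Finset.card_lt_card ((Finset.ssubset_iff_of_subset fun k hk => ?_).2 ⟨i, ?_, ?_⟩)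
  · simp only [Finset.mem_filter_univ] at hk ⊢
    exact hk.trans (reflTransGen_of_mem_pa_comp h)
  · simp [ReflTransGen.refl]
  · simp only [Finset.mem_filter_univ]
    intro hij
    obtain ⟨a, ha, hja⟩ := mem_pa.1 h
    exact hG j a hja ((reachable_of_und (mem_comp.1 ha).symm).trans hij)

end MixedGraph

/-! ### The residual map and block diagonality of the residual covariance -/

section Factorization

open Matrix

lemma Matrix.schur_apply {V : Type*} [Fintype V] [DecidableEq V] (S : Matrix V V ℝ)
    (K A : Finset V) (i j : K) :
    S.schur K A i j = S i j - ∑ l, S.coef A i l * S l j := by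
  rw [S.sum_coef_mul]
  rfl

lemma Matrix.ext_of_quadraticForm {ι : Type*} [Fintype ι] [DecidableEq ι] {M N : Matrix ι ι ℝ}
    (hM : M.IsSymm) (hN : N.IsSymm) (h : ∀ u : ι → ℝ, u ⬝ᵥ M *ᵥ u = u ⬝ᵥ N *ᵥ u) : M = N := by
  have h1 : ∀ (A : Matrix ι ι ℝ), A.IsSymm → ∀ i j, A i j =
      ((Pi.single i 1 + Pi.single j 1 : ι → ℝ) ⬝ᵥ A *ᵥ (Pi.single i 1 + Pi.single j 1) -
        (Pi.single i 1 : ι → ℝ) ⬝ᵥ A *ᵥ (Pi.single i 1) -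
        (Pi.single j 1 : ι → ℝ) ⬝ᵥ A *ᵥ (Pi.single j 1)) / 2 := by
    intro A hA i j
    have := hA.apply i j
    simp only [mulVec_add, dotProduct_add, add_dotProduct, single_dotProduct, mulVec_single_one,
      col_apply, one_mul]
    linarith
  ext i j
  rw [h1 M hM, h1 N hN, h, h, h]

variable {V : Type*} [Fintype V] [DecidableEq V] {G : MixedGraph V} {S : Matrix V V ℝ}

/-- The matrix that maps the variables to the residuals of the regressions of the nodes on the
parents of their components. -/
noncomputable def MixedGraph.residMat (G : MixedGraph V) (S : Matrix V V ℝ) : Matrix V V ℝ :=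
  1 - Matrix.of fun i j => S.coef (G.pa (G.comp i)) i j

lemma MixedGraph.residMat_mulVec (y : V → ℝ) (i : V) :
    (G.residMat S *ᵥ y) i = y i - ∑ l, S.coef (G.pa (G.comp i)) i l * y l := by
  rw [residMat, sub_mulVec, one_mulVec]
  rfl

lemma MixedGraph.residMat_mul (M : Matrix V V ℝ) (i j : V) :
    (G.residMat S * M) i j = M i j - ∑ l, S.coef (G.pa (G.comp i)) i l * M l j := by
  rw [residMat, sub_mul, one_mul]
  rfl

lemma MixedGraph.mul_residMat_transpose (M : Matrix V V ℝ) (i j : V) :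
    (M * (G.residMat S)ᵀ) i j = M i j - ∑ l, S.coef (G.pa (G.comp j)) j l * M i l := by
  rw [← transpose_apply (M * _), transpose_mul, transpose_transpose, residMat_mul]
  rfl

/-- Parents of the component of i have strictly smaller rank than i, so ordering by rank makes the
matrix block triangular with identity diagonal blocks. -/
lemma MixedGraph.IsChainGraph.det_residMat (hG : G.IsChainGraph) : (G.residMat S).det = 1 := by
  have h0 : ∀ i j, G.rank i ≤ G.rank j → G.residMat S i j = (1 : Matrix V V ℝ) i j := by
    intro i j hij
    rw [residMat, Matrix.sub_apply, of_apply, S.coef_of_notMem, sub_zero]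
    exact fun h => (hG.rank_lt h).not_ge hij
  have h : (G.residMat S).BlockTriangular (OrderDual.toDual ∘ G.rank) := by
    intro i j hij
    have hij' : G.rank i < G.rank j := hij
    rw [h0 i j hij'.le, one_apply_ne]
    rintro rfl
    exact hij'.false
  rw [h.det]
  refine Finset.prod_eq_one fun a _ => ?_
  have : (G.residMat S).toSquareBlock (OrderDual.toDual ∘ G.rank) a = 1 := by
    ext ⟨i, hi⟩ ⟨j, hj⟩
    have hij : G.rank i = G.rank j := OrderDual.toDual.injective (hi.trans hj.symm)
    rw [toSquareBlock_def, of_apply, h0 i j hij.le]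
    simp [one_apply]
  rw [this, det_one]

/-- The covariance matrix of the residuals. -/
noncomputable def MixedGraph.residCov (G : MixedGraph V) (S : Matrix V V ℝ) : Matrix V V ℝ :=
  G.residMat S * S * (G.residMat S)ᵀ

/-- Nodes i and j share the parents of their component, and the residual of i is orthogonal to them;
so the residual of j may be replaced by the variable j itself. -/
lemma Matrix.PosDef.residCov_apply_of_mem (hS : S.PosDef) {i j : V} (h : j ∈ G.comp i) :
    G.residCov S i j = S i j - ∑ l, S.coef (G.pa (G.comp i)) i l * S l j := by
  rw [MixedGraph.residCov, MixedGraph.mul_residMat_transpose, ← MixedGraph.residMat_mul,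
    sub_eq_self]
  refine Finset.sum_eq_zero fun l _ => ?_
  by_cases hl : l ∈ G.pa (G.comp j)
  · rw [MixedGraph.comp_eq_of_mem h] at hl
    rw [MixedGraph.residMat_mul, hS.sum_coef_mul_eq i hl, sub_self, mul_zero]
  · rw [S.coef_of_notMem j hl, zero_mul]

lemma Matrix.PosDef.residCov (hS : S.PosDef) (hG : G.IsChainGraph) : (G.residCov S).PosDef := by
  have h := hS.mul_mul_conjTranspose_same (B := G.residMat S) ?_
  · rwa [conjTranspose_eq_transpose_of_trivial] at h
  · refine vecMul_injective_iff_isUnit.2 ((isUnit_iff_isUnit_det _).2 ?_)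
    rw [hG.det_residMat]
    exact isUnit_one

/-- The residuals of different components are uncorrelated iff every residual is uncorrelated
with the nondescendants of its component. -/
lemma Matrix.PosDef.residCov_eq_zero_iff (hS : S.PosDef) (hG : G.IsChainGraph) :
    (∀ i, ∀ j ∉ G.comp i, G.residCov S i j = 0) ↔
      ∀ i, S.ResidOrth (G.pa (G.comp i)) i (G.nd (G.comp i) \ G.comp i) := by
  have hX : ∀ i j, ∑ l, S.coef (G.pa (G.comp i)) i l * S l j = S i j ↔
      (G.residMat S * S) i j = 0 := by
    intro i j
    rw [MixedGraph.residMat_mul, sub_eq_zero, eq_comm]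
  constructor
  · intro h i
    -- Induction on rank: variable j is its residual plus a combination of parents of its component,
    -- which have smaller rank and are again non-descendants outside the component of i.
    have key : ∀ (n : ℕ) (j : V), G.rank j = n → j ∈ G.nd (G.comp i) \ G.comp i →
        (G.residMat S * S) i j = 0 := by
      intro n
      induction n using Nat.strong_induction_on with
      | _ n ih =>
        intro j hjn hj
        obtain ⟨hj1, hj2⟩ := Finset.mem_sdiff.1 hj
        have h1 := h i j hj2
        rw [MixedGraph.residCov, MixedGraph.mul_residMat_transpose, Finset.sum_eq_zero,
          sub_zero] at h1
        · exact h1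
        · intro l _
          by_cases hl : l ∈ G.pa (G.comp j)
          · rw [ih _ (hjn ▸ hG.rank_lt hl) l rfl (MixedGraph.mem_nd_sdiff_of_mem_pa hj1 hl),
              mul_zero]
          · rw [S.coef_of_notMem j hl, zero_mul]
    exact fun j hj => (hX i j).2 (key _ j rfl hj)
  · intro h
    have key : ∀ i j, j ∉ G.comp i → j ∈ G.nd (G.comp i) → G.residCov S i j = 0 := by
      intro i j hj hj'
      have h0 : ∀ l ∈ G.nd (G.comp i) \ G.comp i, (G.residMat S * S) i l = 0 :=
        fun l hl => (hX i l).1 (h i l hl)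
      rw [MixedGraph.residCov, MixedGraph.mul_residMat_transpose,
        h0 j (Finset.mem_sdiff.2 ⟨hj', hj⟩),
        zero_sub, neg_eq_zero]
      refine Finset.sum_eq_zero fun l _ => ?_
      by_cases hl : l ∈ G.pa (G.comp j)
      · rw [h0 l (MixedGraph.mem_nd_sdiff_of_mem_pa hj' hl), mul_zero]
      · rw [S.coef_of_notMem j hl, zero_mul]
    intro i j hj
    -- One of the two nodes is a non-descendant of the other's component; symmetry of the covariance
    -- covers both cases.
    rcases hG.mem_nd_or_mem_nd i j with h1 | h1
    · exact key i j hj h1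
    · rw [(hS.residCov hG).symm_apply]
      refine key j i (fun hi => hj ?_) h1
      rw [MixedGraph.comp_eq_of_mem hi]
      exact MixedGraph.self_mem_comp j

/-- Every node belongs to exactly one chain component. -/
noncomputable def MixedGraph.sigmaComponents (G : MixedGraph V) :
    (Σ K : G.chainComponents, (K : Finset V)) ≃ V :=
  Equiv.ofBijective (fun p => (p.2 : V)) <| by
    constructor
    · rintro ⟨⟨K, hK⟩, ⟨i, hi⟩⟩ ⟨⟨L, hL⟩, ⟨j, hj⟩⟩ h
      obtain rfl : i = j := h
      have h1 := (mem_chainComponents.1 hK).eq_comp hi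
      have h2 := (mem_chainComponents.1 hL).eq_comp hj
      obtain rfl : K = L := h1.trans h2.symm
      rfl
    · intro i
      exact ⟨⟨⟨G.comp i, mem_chainComponents.2 (isChainComponent_comp i)⟩,
        ⟨i, self_mem_comp i⟩⟩, rfl⟩

/-- The diagonal blocks are Schur complements in any case; the content is the vanishing of the
off-diagonal blocks. -/
lemma Matrix.PosDef.residOrth_iff_blockDiagonal (hS : S.PosDef) (hG : G.IsChainGraph) :
    (∀ i, S.ResidOrth (G.pa (G.comp i)) i (G.nd (G.comp i) \ G.comp i)) ↔
      (G.residCov S).submatrix G.sigmaComponents G.sigmaComponents =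
        blockDiagonal' fun K : G.chainComponents => S.schur K (G.pa K) := by
  rw [← hS.residCov_eq_zero_iff hG]
  have hcomp : ∀ p : Σ K : G.chainComponents, (K : Finset V), (p.1 : Finset V) = G.comp p.2 :=
    fun p => (MixedGraph.mem_chainComponents.1 p.1.2).eq_comp p.2.2
  constructor
  · intro h
    ext p q
    by_cases hpq : p.1 = q.1
    · obtain ⟨K, i⟩ := p
      obtain ⟨L, j⟩ := q
      obtain rfl : K = L := hpq
      rw [blockDiagonal'_apply_eq, schur_apply]
      have h1 := hcomp ⟨K, i⟩
      have h2 := hS.residCov_apply_of_mem (G := G) (i := i) (j := j) (h1 ▸ j.2)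
      rw [← h1] at h2
      exact h2
    · rw [blockDiagonal'_apply_ne _ _ _ hpq]
      refine h _ _ fun hq => hpq (Subtype.ext ?_)
      rw [hcomp p, hcomp q]
      exact (MixedGraph.comp_eq_of_mem hq).symm
  · intro h i j hj
    have h1 := congrFun (congrFun h (G.sigmaComponents.symm i)) (G.sigmaComponents.symm j)
    rw [submatrix_apply, Equiv.apply_symm_apply, Equiv.apply_symm_apply] at h1
    rw [h1, blockDiagonal'_apply, dif_neg]
    intro h2
    have h3 := hcomp (G.sigmaComponents.symm i)
    have h4 := hcomp (G.sigmaComponents.symm j)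
    have h5 : ∀ k, ((G.sigmaComponents.symm k).2 : V) = k := G.sigmaComponents.apply_symm_apply
    rw [h5] at h3 h4
    rw [← h3, h2, h4] at hj
    exact hj (MixedGraph.self_mem_comp j)

end Factorization

/-! ### Factorization of the density as a condition on the covariance matrix -/

section Main

open Matrix

variable {V : Type*} [Fintype V] [DecidableEq V] {G : MixedGraph V} {S : Matrix V V ℝ}

lemma gaussConst_prod {ι : Type*} [Fintype ι] (n : ι → ℕ) {d : ι → ℝ} (hd : ∀ k, 0 < d k) :
    ∏ k, gaussConst (n k) (d k) = gaussConst (∑ k, n k) (∏ k, d k) := by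
  simp only [gaussConst, Finset.prod_mul_distrib, Finset.prod_inv_distrib,
    Finset.prod_pow_eq_pow_sum]
  rw [Real.sqrt_prod _ fun k _ => (hd k).le]

lemma Matrix.dotProduct_blockDiagonal'_mulVec {o : Type*} [Fintype o] [DecidableEq o]
    {m : o → Type*} [∀ k, Fintype (m k)] (M : ∀ k, Matrix (m k) (m k) ℝ)
    (u : (Σ k, m k) → ℝ) :
    u ⬝ᵥ blockDiagonal' M *ᵥ u = ∑ k, (fun a => u ⟨k, a⟩) ⬝ᵥ M k *ᵥ fun a => u ⟨k, a⟩ := by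
  simp only [dotProduct, mulVec, Fintype.sum_sigma]
  refine Finset.sum_congr rfl fun k _ => Finset.sum_congr rfl fun a _ => ?_
  congr 1
  rw [Finset.sum_eq_single k]
  · simp
  · intro l _ hl
    exact Finset.sum_eq_zero fun b _ => by rw [blockDiagonal'_apply_ne _ _ _ hl.symm, zero_mul]
  · simp

lemma Matrix.det_blockDiagonal' {o : Type*} [Fintype o] [DecidableEq o]
    {m : o → Type*} [∀ k, Fintype (m k)] [∀ k, DecidableEq (m k)]
    (M : ∀ k, Matrix (m k) (m k) ℝ) : (blockDiagonal' M).det = ∏ k, (M k).det := by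
  -- An arbitrary order on the block indices, needed only to apply the block triangular determinant
  -- formula.
  let _ : LinearOrder o := LinearOrder.lift' (Fintype.equivFin o) (Fintype.equivFin o).injective
  rw [(blockTriangular_blockDiagonal' M).det_fintype]
  refine Finset.prod_congr rfl fun k _ => ?_
  let e : m k ≃ {p : Σ l, m l // p.1 = k} := Equiv.ofBijective (fun a => ⟨⟨k, a⟩, rfl⟩) <| by
    constructor
    · intro a b h
      simpa using h
    · rintro ⟨⟨l, a⟩, rfl⟩
      exact ⟨a, rfl⟩
  rw [← det_submatrix_equiv_self e]
  congr 1
  ext a b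
  exact blockDiagonal'_apply_eq M k a b

omit [DecidableEq V] in
lemma MixedGraph.comp_coe_eq (K : G.chainComponents) (i : (K : Finset V)) :
    G.comp i = K :=
  ((mem_chainComponents.1 K.2).eq_comp i.2).symm

omit [DecidableEq V] in
lemma MixedGraph.IsChainGraph.disjoint_pa (hG : G.IsChainGraph) {K : Finset V}
    (hK : G.IsChainComponent K) : Disjoint K (G.pa K) := by
  obtain ⟨i, hi⟩ := hK.1.1
  rw [hK.eq_comp hi]
  exact hG.disjoint_comp_pa i

/-- Written in the residuals Ry, the two sides are the forms of the inverse residual covariance and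
of the block diagonal matrix of inverse Schur complements. R is invertible, so equality of the forms
is equality of the matrices. -/
lemma Matrix.PosDef.residOrth_iff_precForm (hS : S.PosDef) (hG : G.IsChainGraph) :
    (∀ i, S.ResidOrth (G.pa (G.comp i)) i (G.nd (G.comp i) \ G.comp i)) ↔
      ∀ y : V → ℝ, y ⬝ᵥ S⁻¹ *ᵥ y =
        ∑ K : G.chainComponents, (S.precForm (K ∪ G.pa K) y - S.precForm (G.pa K) y) := by
  set e := G.sigmaComponents
  have hR : IsUnit (G.residMat S).det := by
    rw [hG.det_residMat]
    exact isUnit_one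
  have hschur := fun K : G.chainComponents =>
    hS.schur_aux (hG.disjoint_pa (MixedGraph.mem_chainComponents.1 K.2))
  have hblock : ∀ y : V → ℝ,
      ∑ K : G.chainComponents, (S.precForm (K ∪ G.pa K) y - S.precForm (G.pa K) y) =
        ((G.residMat S *ᵥ y) ∘ e) ⬝ᵥ (blockDiagonal' fun K : G.chainComponents =>
          (S.schur K (G.pa K))⁻¹) *ᵥ ((G.residMat S *ᵥ y) ∘ e) := by
    intro y
    rw [dotProduct_blockDiagonal'_mulVec]
    refine Finset.sum_congr rfl fun K _ => ?_
    rw [(hschur K).2.2.2 y]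
    have h1 : (fun i : (K : Finset V) => y i - ∑ l, S.coef (G.pa K) i l * y l) =
        fun i => ((G.residMat S *ᵥ y) ∘ e) ⟨K, i⟩ := by
      ext i
      have := MixedGraph.residMat_mulVec (G := G) (S := S) y i
      rw [MixedGraph.comp_coe_eq K i] at this
      exact this.symm
    rw [h1]
  have hform : ∀ y : V → ℝ, y ⬝ᵥ S⁻¹ *ᵥ y = ((G.residMat S *ᵥ y) ∘ e) ⬝ᵥ
      ((G.residCov S).submatrix e e)⁻¹ *ᵥ ((G.residMat S *ᵥ y) ∘ e) := by
    intro y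
    have h1 : S⁻¹ = (G.residMat S)ᵀ * (G.residCov S)⁻¹ * G.residMat S := by
      rw [MixedGraph.residCov, mul_inv_rev, mul_inv_rev, ← transpose_nonsing_inv]
      simp only [← Matrix.mul_assoc]
      rw [← transpose_mul, nonsing_inv_mul _ hR, transpose_one, Matrix.one_mul, Matrix.mul_assoc,
        nonsing_inv_mul _ hR, Matrix.mul_one]
    rw [inv_submatrix_equiv, submatrix_mulVec_equiv, Function.comp_assoc, e.self_comp_symm,
      Function.comp_id, comp_equiv_dotProduct_comp_equiv, h1, ← mulVec_mulVec, ← mulVec_mulVec,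
      dotProduct_mulVec, vecMul_transpose]
  have hΛ : (blockDiagonal' fun K : G.chainComponents => S.schur K (G.pa K))⁻¹ =
      blockDiagonal' fun K : G.chainComponents => (S.schur K (G.pa K))⁻¹ := by
    refine inv_eq_left_inv ?_
    rw [← blockDiagonal'_mul, ← blockDiagonal'_one]
    congr 1
    ext1 K
    exact nonsing_inv_mul _ (hschur K).1.det_pos.ne'.isUnit
  rw [hS.residOrth_iff_blockDiagonal hG]
  simp_rw [hblock, hform]
  have hpd : ((G.residCov S).submatrix e e).PosDef := (hS.residCov hG).submatrix e.injective
  constructor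
  · intro h y
    rw [h, hΛ]
  · intro h
    have h2 : ((G.residCov S).submatrix e e)⁻¹ = blockDiagonal' fun K : G.chainComponents =>
          (S.schur K (G.pa K))⁻¹ := by
      refine ext_of_quadraticForm ?_ ?_ fun u => ?_
      · have := hpd.inv.isHermitian
        rwa [IsHermitian, conjTranspose_eq_transpose_of_trivial] at this
      · rw [IsSymm, blockDiagonal'_transpose]
        congr 1
        ext1 K
        have := (hschur K).1.inv.isHermitian
        rwa [IsHermitian, conjTranspose_eq_transpose_of_trivial] at this
      · have h3 : (G.residMat S *ᵥ ((G.residMat S)⁻¹ *ᵥ (u ∘ e.symm))) ∘ e = u := by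
          rw [mulVec_mulVec, mul_nonsing_inv _ hR, one_mulVec, Function.comp_assoc,
            e.symm_comp_self, Function.comp_id]
        have := h ((G.residMat S)⁻¹ *ᵥ (u ∘ e.symm))
        rwa [h3] at this
    rw [← nonsing_inv_nonsing_inv _ hpd.det_pos.ne'.isUnit, h2, ← hΛ, nonsing_inv_nonsing_inv]
    rw [det_blockDiagonal']
    exact (Finset.prod_pos fun K _ => (hschur K).1.det_pos).ne'.isUnit

/-- As det R = 1, det S is the determinant of the residual covariance, hence the product of those of
its diagonal blocks. -/
lemma Matrix.PosDef.gaussConst_eq (hS : S.PosDef) (hG : G.IsChainGraph)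
    (h : ∀ i, S.ResidOrth (G.pa (G.comp i)) i (G.nd (G.comp i) \ G.comp i)) :
    gaussConst (Fintype.card V) S.det =
      ∏ K : G.chainComponents, gaussConst (K : Finset V).card (S.schur K (G.pa K)).det := by
  have hschur := fun K : G.chainComponents =>
    hS.schur_aux (hG.disjoint_pa (MixedGraph.mem_chainComponents.1 K.2))
  rw [gaussConst_prod _ fun K => (hschur K).1.det_pos]
  congr 1
  · rw [← Fintype.card_congr G.sigmaComponents, Fintype.card_sigma]
    simp
  · have h1 := congrArg det ((hS.residOrth_iff_blockDiagonal hG).1 h)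
    rw [det_submatrix_equiv_self, det_blockDiagonal', MixedGraph.residCov, det_mul, det_mul,
      det_transpose, hG.det_residMat, one_mul, mul_one] at h1
    exact h1

/-- The factorization of a Gaussian distribution along the chain components in terms of the
covariance matrix. -/
theorem factorizes_iff {P : Measure (V → ℝ)} [IsGaussian P] (hP : (covMat P).PosDef)
    (hG : G.IsChainGraph) :
    Factorizes G P ↔
      ∀ i, (covMat P).ResidOrth (G.pa (G.comp i)) i (G.nd (G.comp i) \ G.comp i) := by
  set S := covMat P with hSdef
  let m : V → ℝ := fun i => ∫ x, x i ∂P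
  let c := gaussConst (Fintype.card V) S.det
  let cK : G.chainComponents → ℝ := fun K =>
    gaussConst (K : Finset V).card (S.schur K (G.pa K)).det
  let q : (V → ℝ) → ℝ := fun y => y ⬝ᵥ S⁻¹ *ᵥ y
  let qK : (V → ℝ) → ℝ := fun y =>
    ∑ K : G.chainComponents, (S.precForm (K ∪ G.pa K) y - S.precForm (G.pa K) y)
  have hq : Continuous q := by fun_prop
  have hform : ∀ A : Finset V, Continuous (S.precForm A) := fun A => by
    unfold Matrix.precForm
    fun_prop
  have hqK : Continuous qK := by fun_prop
  have hschur := fun K : G.chainComponents =>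
    hP.schur_aux (hG.disjoint_pa (MixedGraph.mem_chainComponents.1 K.2))
  have hcK : ∀ K, 0 < cK K := fun K => gaussConst_pos _ (hschur K).1.det_pos
  have hc : 0 < c := gaussConst_pos _ hP.det_pos
  have h1 : Factorizes G P ↔ (fun x : V → ℝ => c * Real.exp (-q (fun i => x i - m i) / 2))
      =ᵐ[volume] fun x => (∏ K, cK K) * Real.exp (-qK (fun i => x i - m i) / 2) := by
    have hall : ∀ᵐ x ∂(volume : Measure (V → ℝ)), ∀ K : G.chainComponents,
        condDensity P K (G.pa K) x = ENNReal.ofReal (cK K * Real.exp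
          (-(S.precForm (K ∪ G.pa K) (fun i => x i - m i) -
            S.precForm (G.pa K) (fun i => x i - m i)) / 2)) :=
      ae_all_iff.2 fun K =>
        condDensity_ae_eq hP (hG.disjoint_pa (MixedGraph.mem_chainComponents.1 K.2))
    refine Filter.eventually_congr ?_
    filter_upwards [hall, rnDeriv_gaussian P hP] with x hx hx'
    have hprod : ∏ K ∈ G.chainComponents, condDensity P K (G.pa K) x =
        ENNReal.ofReal ((∏ K, cK K) * Real.exp (-qK (fun i => x i - m i) / 2)) := by
      rw [← Finset.prod_coe_sort, Finset.prod_congr rfl fun K _ => hx K,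
        ← ENNReal.ofReal_prod_of_nonneg fun K _ => (mul_pos (hcK K) (Real.exp_pos _)).le,
        Finset.prod_mul_distrib, ← Real.exp_sum, ← Finset.sum_div, Finset.sum_neg_distrib]
    rw [hprod, hx']
    refine ENNReal.ofReal_eq_ofReal_iff (mul_pos hc (Real.exp_pos _)).le
      (mul_pos (Finset.prod_pos fun K _ => hcK K) (Real.exp_pos _)).le
  -- Both densities are continuous, so almost-everywhere equality is equality at each point.
  rw [h1, Continuous.ae_eq_iff_eq volume (by fun_prop) (by fun_prop)]
  constructor
  · intro h
    rw [hP.residOrth_iff_precForm hG]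
    have h2 : ∀ y, c * Real.exp (-q y / 2) = (∏ K, cK K) * Real.exp (-qK y / 2) := by
      intro y
      have := congrFun h (fun i => y i + m i)
      simpa using this
    -- At the mean both exponentials equal 1, which isolates the constants.
    have h3 : c = ∏ K, cK K := by
      have h4 : qK 0 = 0 := by simp [qK, Matrix.precForm, dotProduct]
      have := h2 0
      rw [h4] at this
      simpa [q] using this
    intro y
    have h5 := h2 y
    rw [← h3] at h5
    have h6 := Real.exp_injective (mul_left_cancel₀ hc.ne' h5)
    change q y = qK y
    linarith
  · intro h
    have h2 := (hP.residOrth_iff_precForm hG).1 h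
    have h3 : c = ∏ K, cK K := hP.gaussConst_eq hG h
    ext x
    rw [h3]
    have h4 : q (fun i => x i - m i) = qK (fun i => x i - m i) := h2 _
    rw [h4]

end Main

/-! ### The Markov property and the zero restrictions as regression conditions -/

section BlockRecursive

variable {V : Type*} [Fintype V] [DecidableEq V] {G : MixedGraph V} {S : Matrix V V ℝ}
  {K : Finset V} {i : V}

omit [DecidableEq V] in
lemma MixedGraph.fa_mono {X Y : Finset V} (h : X ⊆ Y) : G.fa X ⊆ G.fa Y := fun b hb => by
  obtain ⟨a, ha, hab⟩ := mem_fa.1 hb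
  exact mem_fa.2 ⟨a, h ha, hab⟩

omit [DecidableEq V] in
lemma MixedGraph.mo_mono {X Y : Finset V} (h : X ⊆ Y) : G.mo X ⊆ G.mo Y := fun b hb => by
  obtain ⟨a, ha, hab⟩ := mem_mo.1 hb
  exact mem_mo.2 ⟨a, h ha, hab⟩

lemma MixedGraph.IsChainGraph.pa_subset_nd_sdiff (hG : G.IsChainGraph)
    (hK : G.IsChainComponent K) : G.pa K ⊆ G.nd K \ K := by
  obtain ⟨i, hi⟩ := hK.1.1
  rw [hK.eq_comp hi]
  exact fun l hl => mem_nd_sdiff_of_mem_pa (hG.comp_subset_nd i (self_mem_comp i)) hl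

/-- The regressors are enlarged to Pa(K) ⊆ Nd(K) \ K. The added ones are exactly Mo(K) \ Mo(i),
because fathers and mothers of K are disjoint. -/
lemma Matrix.PosDef.residOrth_mothers_iff (hS : S.PosDef) (hG : G.IsUCG)
    (hK : G.IsChainComponent K) (hi : i ∈ K) :
    S.ResidOrth (G.fa K ∪ G.mo {i}) i (((G.nd K \ K) \ G.fa K) \ G.mo {i}) ↔
      (∀ j ∈ G.mo K \ G.mo {i}, S.coef (G.pa K) i j = 0) ∧
        S.ResidOrth (G.pa K) i (G.nd K \ K) := by
  have hmo : G.mo {i} ⊆ G.mo K := MixedGraph.mo_mono (Finset.singleton_subset_iff.2 hi)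
  have hdisj := hG.disjoint_fa_mo K hK
  have hpa := hG.isChainGraph.pa_subset_nd_sdiff hK
  rw [hS.residOrth_union_iff (B := G.nd K \ K)
      (Finset.sdiff_subset.trans Finset.sdiff_subset) (fun j hj => ?_),
    hS.residOrth_iff (C' := G.pa K) ?_ hpa]
  · have : G.pa K \ (G.fa K ∪ G.mo {i}) = G.mo K \ G.mo {i} := by
      rw [MixedGraph.pa_eq]
      ext j
      have h2 := fun h : j ∈ _ => Finset.disjoint_left.1 hdisj h
      simp only [Finset.mem_sdiff, Finset.mem_union]
      tauto
    rw [this]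
  · rw [MixedGraph.pa_eq]
    exact Finset.union_subset_union_right hmo
  · simp only [Finset.mem_union, Finset.mem_sdiff] at hj ⊢
    tauto

lemma Matrix.PosDef.residOrth_fathers_iff (hS : S.PosDef) (hG : G.IsUCG)
    (hK : G.IsChainComponent K) (hi : i ∈ K) :
    S.ResidOrth ((K \ {i}) ∪ G.fa {i} ∪ G.mo K) i (((G.nd K \ K) \ G.fa {i}) \ G.mo K) ↔
      (∀ j ∈ G.fa K \ G.fa {i}, S.coef ((K ∪ G.pa K) \ {i}) i j = 0) ∧
        S.ResidOrth ((K ∪ G.pa K) \ {i}) i (G.nd K \ K) := by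
  have hfa : G.fa {i} ⊆ G.fa K := MixedGraph.fa_mono (Finset.singleton_subset_iff.2 hi)
  have hdisj := hG.disjoint_fa_mo K hK
  have hpa := hG.isChainGraph.pa_subset_nd_sdiff hK
  have hKpa := hG.isChainGraph.disjoint_pa hK
  rw [MixedGraph.pa_eq] at hpa hKpa ⊢
  have h1 : ∀ j, j = i → j ∈ K := fun j hj => hj ▸ hi
  -- The larger regressor set meets K and so need not lie in Nd(K) \ K; it is first adjoined to the
  -- target set on both sides.
  rw [hS.residOrth_union_iff (B := (G.nd K \ K) ∪ (K ∪ (G.fa K ∪ G.mo K)) \ {i})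
      (B' := G.nd K \ K) Finset.subset_union_left (Finset.union_subset_union_right subset_rfl),
    hS.residOrth_union_iff (B := (G.nd K \ K) ∪ (K ∪ (G.fa K ∪ G.mo K)) \ {i})
      ?_ (fun j hj => ?_),
    hS.residOrth_iff (C' := (K ∪ (G.fa K ∪ G.mo K)) \ {i}) (fun j hj => ?_)
      Finset.subset_union_right]
  · have : ((K ∪ (G.fa K ∪ G.mo K)) \ {i}) \ ((K \ {i}) ∪ G.fa {i} ∪ G.mo K) =
        G.fa K \ G.fa {i} := by
      ext j
      have h2 := fun h : j ∈ _ => Finset.disjoint_left.1 hdisj h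
      have h3 := fun h : j ∈ _ => Finset.disjoint_left.1 hKpa h
      have h4 := h1 j
      simp only [Finset.mem_sdiff, Finset.mem_union, Finset.mem_singleton] at h3 ⊢
      tauto
    rw [this]
  · have h2 := @hfa j
    have h3 := fun h : j ∈ _ => Finset.disjoint_left.1 hKpa h
    have h4 := h1 j
    simp only [Finset.mem_sdiff, Finset.mem_union, Finset.mem_singleton] at h3 hj ⊢
    tauto
  · exact (Finset.sdiff_subset.trans Finset.sdiff_subset).trans Finset.subset_union_left
  · have h2 := @hpa j
    simp only [Finset.mem_sdiff, Finset.mem_union, Finset.mem_singleton] at h2 hj ⊢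
    tauto

/-- Here j is the only regressor added, and orthogonality to the full regressor set is automatic. -/
lemma Matrix.PosDef.residOrth_singleton_iff (hS : S.PosDef) {U : Finset V} {j : V}
    (hj : j ∈ U) (hij : j ≠ i) :
    S.ResidOrth (U \ {i, j}) i {j} ↔ S.coef (U \ {i}) i j = 0 := by
  rw [hS.residOrth_union_iff (B := U \ {i}) (by simp [hj, hij]) (fun k hk => ?_),
    hS.residOrth_iff (C' := U \ {i}) (fun k hk => ?_) subset_rfl]
  · have : (U \ {i}) \ (U \ {i, j}) = {j} := by
      ext k
      simp only [Finset.mem_sdiff, Finset.mem_singleton, Finset.mem_insert]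
      constructor
      · tauto
      · rintro rfl
        tauto
    rw [this]
    simp only [Finset.mem_singleton, forall_eq]
    exact and_iff_left fun k hk => hS.sum_coef_mul_eq i hk
  · simp only [Finset.mem_sdiff, Finset.mem_singleton, Finset.mem_insert] at hk ⊢
    tauto
  · simp only [Finset.mem_sdiff, Finset.mem_singleton, Finset.mem_insert, Finset.mem_union] at hk ⊢
    tauto

lemma MixedGraph.IsUCG.zeroRestrictions_iff (hG : G.IsUCG) {P : Measure (V → ℝ)}
    (hP : (covMat P).PosDef) :
    ZeroRestrictions G P ↔ ∀ K, G.IsChainComponent K → ∀ i ∈ K,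
      (∀ j ∈ G.mo K \ G.mo {i}, (covMat P).coef (G.pa K) i j = 0) ∧
      (∀ j ∈ G.fa K \ G.fa {i}, (covMat P).coef ((K ∪ G.pa K) \ {i}) i j = 0) ∧
      (∀ j ∈ (K \ {i}) \ G.ne {i}, (covMat P).coef ((K ∪ G.pa K) \ {i}) i j = 0) := by
  have hreg : ∀ (K : Finset V) (i : K) (j : G.pa K),
      regCoef P K (G.pa K) i j = (covMat P).coef (G.pa K) i j := fun K i j =>
    ((covMat P).coef_coe _ j).symm
  have hprec : ∀ (U : Finset V) (i j : U), (j : V) ≠ i →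
      (precMat P U i j = 0 ↔ (covMat P).coef (U \ {(i : V)}) i j = 0) := fun U i j hij =>
    hP.inv_diagBlock_eq_zero_iff i j hij
  have hcond : ∀ (K : Finset V), G.IsChainComponent K → ∀ (i j : K),
      (condCov P K (G.pa K))⁻¹ i j = precMat P (K ∪ G.pa K)
        ⟨i, Finset.mem_union_left _ i.2⟩ ⟨j, Finset.mem_union_left _ j.2⟩ := fun K hK i j =>
    ((hP.schur_aux (hG.isChainGraph.disjoint_pa hK)).2.2.1 i j).symm
  have hfaK : ∀ K, G.IsChainComponent K → ∀ j ∈ G.fa K, j ∉ K ∧ j ∈ G.pa K := fun K hK j hj => by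
    have hj' : j ∈ G.pa K := by
      rw [G.pa_eq]
      exact Finset.mem_union_left _ hj
    exact ⟨Finset.disjoint_right.1 (hG.isChainGraph.disjoint_pa hK) hj', hj'⟩
  constructor
  · rintro ⟨h1, h2, h3⟩ K hK i hi
    refine ⟨fun j hj => ?_, fun j hj => ?_, fun j hj => ?_⟩
    · have hj' : j ∈ G.pa K := by
        rw [G.pa_eq]
        exact Finset.mem_union_right _ (Finset.mem_sdiff.1 hj).1
      exact (hreg K ⟨i, hi⟩ ⟨j, hj'⟩).symm.trans (h1 K hK ⟨i, hi⟩ ⟨j, hj'⟩ hj)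
    · obtain ⟨hj1, hj2⟩ := hfaK K hK j (Finset.mem_sdiff.1 hj).1
      exact (hprec _ ⟨i, Finset.mem_union_left _ hi⟩ ⟨j, Finset.mem_union_right _ hj2⟩
        fun h : j = i => hj1 (h ▸ hi)).1 (h2 K hK _ _ hi hj)
    · obtain ⟨hjK, hji⟩ := Finset.mem_sdiff.1 (Finset.mem_sdiff.1 hj).1
      have := h3 K hK ⟨i, hi⟩ ⟨j, hjK⟩ hj
      rw [hcond K hK] at this
      exact (hprec _ _ _ fun h => hji (Finset.mem_singleton.2 h)).1 this
  · intro h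
    refine ⟨fun K hK i j hj => ?_, fun K hK i j hi hj => ?_, fun K hK i j hj => ?_⟩
    · rw [hreg]
      exact (h K hK i i.2).1 j hj
    · obtain ⟨hj1, -⟩ := hfaK K hK j (Finset.mem_sdiff.1 hj).1
      exact (hprec _ i j fun hij => hj1 (hij ▸ hi)).2 ((h K hK i hi).2.1 j hj)
    · rw [hcond K hK, hprec _ _ _ ?_]
      · exact (h K hK i i.2).2.2 j hj
      · have := (Finset.mem_sdiff.1 (Finset.mem_sdiff.1 hj).1).2
        exact fun h => this (Finset.mem_singleton.2 h)

lemma MixedGraph.IsUCG.blockRecursiveMarkov_iff (hG : G.IsUCG) {P : Measure (V → ℝ)}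
    [IsGaussian P] (hP : (covMat P).PosDef) :
    BlockRecursiveMarkov G P ↔ ∀ K, G.IsChainComponent K → ∀ i ∈ K,
      ((∀ j ∈ G.mo K \ G.mo {i}, (covMat P).coef (G.pa K) i j = 0) ∧
        (covMat P).ResidOrth (G.pa K) i (G.nd K \ K)) ∧
      ((∀ j ∈ G.fa K \ G.fa {i}, (covMat P).coef ((K ∪ G.pa K) \ {i}) i j = 0) ∧
        (covMat P).ResidOrth ((K ∪ G.pa K) \ {i}) i (G.nd K \ K)) ∧
      (∀ j ∈ (K \ {i}) \ G.ne {i}, (covMat P).coef ((K ∪ G.pa K) \ {i}) i j = 0) := by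
  have h3 : ∀ K, G.IsChainComponent K → ∀ i ∈ K, ∀ j ∈ (K \ {i}) \ G.ne {i},
      (CondIndepGiven P {i} {j} ((K \ {i, j}) ∪ G.pa K) ↔
        (covMat P).coef ((K ∪ G.pa K) \ {i}) i j = 0) := by
    intro K hK i hi j hj
    obtain ⟨hjK, hji⟩ := Finset.mem_sdiff.1 (Finset.mem_sdiff.1 hj).1
    have hpa := hG.isChainGraph.disjoint_pa hK
    have : (K \ {i, j}) ∪ G.pa K = (K ∪ G.pa K) \ {i, j} := by
      rw [Finset.union_sdiff_distrib, Finset.sdiff_eq_self_of_disjoint (s := G.pa K)]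
      refine (Finset.disjoint_of_subset_left ?_ hpa).symm
      exact Finset.insert_subset hi (Finset.singleton_subset_iff.2 hjK)
    rw [condIndepGiven_singleton_iff hP, this]
    exact hP.residOrth_singleton_iff (Finset.mem_union_left _ hjK)
      fun h => hji (Finset.mem_singleton.2 h)
  constructor
  · rintro ⟨b1, b2, b3⟩ K hK i hi
    refine ⟨?_, ?_, fun j hj => (h3 K hK i hi j hj).1 (b3 K hK i hi j hj)⟩
    · exact (hP.residOrth_mothers_iff hG hK hi).1
        ((condIndepGiven_singleton_iff hP _ _ _).1 (b1 K hK i hi))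
    · exact (hP.residOrth_fathers_iff hG hK hi).1
        ((condIndepGiven_singleton_iff hP _ _ _).1 (b2 K hK i hi))
  · intro h
    refine ⟨fun K hK i hi => ?_, fun K hK i hi => ?_, fun K hK i hi j hj => ?_⟩
    · exact (condIndepGiven_singleton_iff hP _ _ _).2
        ((hP.residOrth_mothers_iff hG hK hi).2 (h K hK i hi).1)
    · exact (condIndepGiven_singleton_iff hP _ _ _).2
        ((hP.residOrth_fathers_iff hG hK hi).2 (h K hK i hi).2.1)
    · exact (h3 K hK i hi j hj).2 ((h K hK i hi).2.2 j hj)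

end BlockRecursive

theorem mainTheorem3 {V : Type*} [Fintype V] [DecidableEq V] (G : MixedGraph V) (hG : G.IsUCG)
    (P : Measure (V → ℝ)) [IsGaussian P] (hP : (covMat P).PosDef) :
    (Factorizes G P ∧ ZeroRestrictions G P) ↔ BlockRecursiveMarkov G P := by
  rw [factorizes_iff hP hG.isChainGraph, hG.zeroRestrictions_iff hP,
    hG.blockRecursiveMarkov_iff hP]
  constructor
  · rintro ⟨hF, hZ⟩ K hK i hi
    have hF' : ∀ k ∈ K, (covMat P).ResidOrth (G.pa K) k (G.nd K \ K) := by
      intro k hk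
      have := hF k
      rwa [← hK.eq_comp hk] at this
    obtain ⟨h1, h2, h3⟩ := hZ K hK i hi
    -- The orthogonality required by (B2) uses the factorization for every member of K, not for i
    -- alone.
    exact ⟨⟨h1, hF' i hi⟩, ⟨h2, hP.residOrth_extend hF' hi
      (Finset.disjoint_left.1 (hG.isChainGraph.disjoint_pa hK) hi)⟩, h3⟩
  · intro h
    refine ⟨fun i => ?_, fun K hK i hi => ⟨(h K hK i hi).1.1, (h K hK i hi).2.1.1,
      (h K hK i hi).2.2⟩⟩
    exact (h _ (MixedGraph.isChainComponent_comp i) i (MixedGraph.self_mem_comp i)).1.2
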